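/- **Problem.** Let $d,n\ge 1$, $N_1,\dots,N_n\ge 1$, $N=\sum_{i=1}^n N_i$, $\lambda\ge 0$, and consider, over $x=(x_1,\dots,x_n)\in(\mathbb R^d)^n$ with $\bar x=\frac1n\sum_i x_i$, $$\min_x\ F(x)+\sum_{i=1}^n R_i(x_i),\qquad F(x)=\frac1N\sum_{i=1}^n\sum_{j=1}^{N_i} f_{i,j}(x_i)+\frac{\lambda}{2n}\sum_{i=1}^n\|x_i-\bar x\|^2 .$$ Assume that each $R_i:\mathbb R^d\to\mathbb R\cup\{+\infty\}$ is proper, closed and convex; that each $f_{i,j}:\mathbb R^d\to\mathbb R$ is differentiable, convex and $M_{i,j}$-smooth with a symmetric positive definite matrix $M_{i,j}$, i.e. for all $x,y\in\mathbb R^d$ $$f_{i,j}(y)+\langle\nabla f_{i,j}(y),x-y\rangle\le f_{i,j}(x)\le f_{i,j}(y)+\langle\nabla f_{i,j}(y),x-y\rangle+\tfrac12\langle x-y,M_{i,j}(x-y)\rangle ;$$ and that, for some $\mu>0$, each local objective $f_i=\frac nN\sum_{j=1}^{N_i}f_{i,j}$ is $\mu$-strongly convex. **Sampling.** Let $0<p<1$,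 let $\mathcal D$ be a probability distribution on subsets of $\{1,\dots,n\}$ and $\mathcal D_i$ one on subsets of $\{1,\dots,N_i\}$. Put $p_i=\mathbb P(i\in\mathcal S)$ for $\mathcal S\sim\mathcal D$ and $p_{i,j}=\mathbb P(j\in S_i)$ for $S_i\sim\mathcal D_i$, and assume that all $p_i$ and $p_{i,j}$ are positive. Let $v_{i,j}\in\mathbb R$ satisfy the ESO inequality $$\mathbb E\Big\|\sum_{j\in S_i}M_{i,j}^{1/2}h_j\Big\|^2\le\sum_{j=1}^{N_i}p_{i,j}v_{i,j}\|h_j\|^2\qquad\text{for all } i \text{ and all } h_1,\dots,h_{N_i}\in\mathbb R^d .$$ **Algorithm (L2SGD++, SAGA option).** Start from any $x^0\in(\mathbb R^d)^n$ and $J^0_{i,j}=0$, $\Psi^0_i=0$ in $\mathbb R^d$. In iteration $k$, independently of the past, with probability $p$ (aggregation) set, for all $i$, $$g_i^k=\tfrac{\lambda}{np}(x_i^k-\bar x^k)-\tfrac{p^{-1}-1}{n}\Psi_i^k+\tfrac1N\sum_jJ^k_{i,j},\qquad \Psi_i^{k+1}=\lambda(x_i^k-\bar x^k),\qquad J^{k+1}=J^k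 ;$$ otherwise sample $\mathcal S\sim\mathcal D$ and $S_i\sim\mathcal D_i$, all independent, and set $$g_i^k=\frac{\mathbf 1_{\{i\in\mathcal S\}}}{N(1-p)p_i}\sum_{j\in S_i}\frac{\nabla f_{i,j}(x_i^k)-J_{i,j}^k}{p_{i,j}}+\frac1N\sum_jJ_{i,j}^k+\frac1n\Psi_i^k,\qquad \Psi^{k+1}=\Psi^k,$$ with $J^{k+1}_{i,j}=\nabla f_{i,j}(x_i^k)$ if $i\in\mathcal S$ and $j\in S_i$, and $J^{k+1}_{i,j}=J^k_{i,j}$ otherwise. In both cases $x_i^{k+1}=\operatorname{prox}_{\alpha R_i}(x_i^k-\alpha g_i^k)$, where $\operatorname{prox}_{\alpha R_i}(z)=\arg\min_u\{\alpha R_i(u)+\frac12\|u-z\|^2\}$. **Theorem.** Let $$\alpha=\min\Big\{\min_{i,j}\frac{N(1-p)p_{i,j}p_i}{4v_{i,j}+N\mu/n},\ \frac{np}{4\lambda+\mu}\Big\}.$$ Then $\alpha>0$, $0<\alpha\mu/n<1$, the problem has a unique minimizer $x^\star$, and with $$V^k=\sum_i\|x_i^k-x_i^\star\|^2+\alpha\Big(\sum_{i,j}\frac{\big\langle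 w_{i,j}^k,M_{i,j}^{-1}w_{i,j}^k\big\rangle}{2N(1-p)p_{i,j}p_i}+\frac{1}{2n\lambda p}\sum_i\|\Psi_i^k-\lambda(x_i^\star-\bar x^\star)\|^2\Big),\quad w_{i,j}^k=J_{i,j}^k-\nabla f_{i,j}(x_i^\star)$$ (the last term being $0$ if $\lambda=0$), the quantities $V^k$ and $\sum_i\|x_i^k-x_i^\star\|^2$ are integrable and $$\mathbb E[V^k]\le\Big(1-\frac{\alpha\mu}{n}\Big)^kV^0\qquad\text{for all }k\ge0 .$$ In particular, for every $\varepsilon\in(0,1)$ and every integer $k\ge 0$ with $$k\ \ge\ \max\Big\{\max_{i,j}\frac{4v_{i,j}\frac nN+\mu}{\mu(1-p)p_{i,j}p_i},\ \frac{4\lambda+\mu}{p\mu}\Big\}\log\frac1\varepsilon$$ one has $\mathbb E[V^k]\le\varepsilon V^0$, and hence $\mathbb E\big[\sum_i\|x_i^k-x_i^\star\|^2\big]\le\varepsilon V^0$. -/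

import Mathlib

namespace L2SGD

noncomputable section

open scoped MatrixOrder

/-- The space of (local) models, with its Euclidean norm. -/
abbrev Model (d : ℕ) : Type := EuclideanSpace ℝ (Fin d)

/-- The squared weighted norm `‖w‖²_A = ⟨w, A w⟩`. -/
def weightedSq {d : ℕ} (A : Matrix (Fin d) (Fin d) ℝ) (w : Model d) : ℝ :=
  inner ℝ w (Matrix.toEuclideanCLM (𝕜 := ℝ) A w)

/-- `φ` is differentiable, convex (first-order form) and smooth with respect to the matrix `A`. -/
def ConvexMatrixSmooth {d : ℕ} (A : Matrix (Fin d) (Fin d) ℝ) (φ : Model d → ℝ) : Prop :=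
  Differentiable ℝ φ ∧ ∀ x y : Model d,
    φ y + inner ℝ (gradient φ y) (x - y) ≤ φ x ∧
    φ x ≤ φ y + inner ℝ (gradient φ y) (x - y) + 1 / 2 * weightedSq A (x - y)

/-- Proper, closed (lower semicontinuous) and convex extended-real-valued function;
convexity is convexity of the epigraph. -/
structure ProperClosedConvex {d : ℕ} (r : Model d → EReal) : Prop where
  ne_bot : ∀ z, r z ≠ ⊥
  exists_ne_top : ∃ z, r z ≠ ⊤
  closed : LowerSemicontinuous r
  convex : Convex ℝ {q : Model d × ℝ | r q.1 ≤ (q.2 : EReal)}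

/-- `u` minimizes `α r(·) + ½ ‖· - z‖²`. -/
def IsProx {d : ℕ} (α : ℝ) (r : Model d → EReal) (z u : Model d) : Prop :=
  ∀ y : Model d, (α : EReal) * r u + ((1 / 2 * ‖u - z‖ ^ 2 : ℝ) : EReal)
    ≤ (α : EReal) * r y + ((1 / 2 * ‖y - z‖ ^ 2 : ℝ) : EReal)

/-- The proximal operator `prox_{α r}(z) = argmin_u (α r(u) + ½ ‖u - z‖²)`. For `α > 0` and `r`
proper closed convex the minimizer exists and is unique, so that the choice is immaterial. -/
def prox {d : ℕ} (α : ℝ) (r : Model d → EReal) (z : Model d) : Model d :=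
  Classical.epsilon (IsProx α r z)

/-- The data of the optimization problem: `n` clients, client `i` owns `m i` loss functions
`f i j` and a regularizer `R i`; `lam` is the penalty parameter. -/
structure Problem (d n : ℕ) (m : Fin n → ℕ) where
  f : (i : Fin n) → Fin (m i) → Model d → ℝ
  R : Fin n → Model d → EReal
  lam : ℝ

/-- The random mechanism: aggregation probability `p`, distribution of the set of active clients,
distribution of the set of local indices sampled by each client. -/
structure Sampling (n : ℕ) (m : Fin n → ℕ) where
  p : ℝ
  clients : PMF (Finset (Fin n))
  loc : (i : Fin n) → PMF (Finset (Fin (m i)))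

/-- The total number of data points `N`. -/
def total {n : ℕ} (m : Fin n → ℕ) : ℝ := ∑ i, (m i : ℝ)

/-- The average `x̄` of the local models. -/
def average {d n : ℕ} (x : Fin n → Model d) : Model d := (n : ℝ)⁻¹ • ∑ i, x i

namespace Problem

variable {d n : ℕ} {m : Fin n → ℕ}

/-- The local objective `f_i = (n / N) ∑_j f_{i,j}`. -/
def localObj (P : Problem d n m) (i : Fin n) (z : Model d) : ℝ :=
  (n : ℝ) / total m * ∑ j, P.f i j z

/-- The smooth part `F(x) = (1/N) ∑_i ∑_j f_{i,j}(x_i) + λ (1/(2n)) ∑_i ‖x_i - x̄‖²`. -/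
def smoothPart (P : Problem d n m) (x : Fin n → Model d) : ℝ :=
  1 / total m * (∑ i, ∑ j, P.f i j (x i))
    + P.lam * (1 / (2 * (n : ℝ)) * ∑ i, ‖x i - average x‖ ^ 2)

/-- The full objective `F(x) + ∑_i R_i(x_i)`. -/
def objective (P : Problem d n m) (x : Fin n → Model d) : EReal :=
  (P.smoothPart x : EReal) + ∑ i, P.R i (x i)

def IsMinimizer (P : Problem d n m) (x : Fin n → Model d) : Prop :=
  ∀ y : Fin n → Model d, P.objective x ≤ P.objective y

end Problem

/-- The probability that the index `a` belongs to a random subset with distribution `D`. -/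
def inclusionProb {ι : Type*} [Fintype ι] [DecidableEq ι] (D : PMF (Finset ι)) (a : ι) : ℝ :=
  ∑ S : Finset ι, if a ∈ S then (D S).toReal else 0

/-- The outcome of the random choices made in one iteration: `coin = true` means aggregation,
`active` is the set of active clients, and `batch i` the subset of indices sampled by client `i`
(used only if there is no aggregation and `i` is active). -/
structure Draw (n : ℕ) (m : Fin n → ℕ) where
  coin : Bool
  active : Finset (Fin n)
  batch : (i : Fin n) → Finset (Fin (m i))

/-- Discrete σ-algebra: there are only finitely many outcomes. -/
instance {n : ℕ} {m : Fin n → ℕ} : MeasurableSpace (Draw n m) := ⊤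

namespace Sampling

variable {n : ℕ} {m : Fin n → ℕ}

/-- The probability `p_i` that client `i` is active. -/
def clientProb (S : Sampling n m) (i : Fin n) : ℝ := inclusionProb S.clients i

/-- The probability `p_{i,j}` that client `i` samples its index `j`. -/
def indexProb (S : Sampling n m) (i : Fin n) (j : Fin (m i)) : ℝ := inclusionProb (S.loc i) j

/-- The probability of an outcome: coin, active set and all local subsets are independent. -/
def drawProb (S : Sampling n m) (ω : Draw n m) : ℝ :=
  (if ω.coin then S.p else 1 - S.p) * (S.clients ω.active).toReal
    * ∏ i, (S.loc i (ω.batch i)).toReal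

/-- The expected separable overapproximation inequality with parameters `v`:
`E ‖∑_{j ∈ S_i} M_{i,j}^{1/2} h_j‖² ≤ ∑_j p_{i,j} v_{i,j} ‖h_j‖²`. -/
def ESO {d : ℕ} (S : Sampling n m)
    (M : (i : Fin n) → Fin (m i) → Matrix (Fin d) (Fin d) ℝ)
    (v : (i : Fin n) → Fin (m i) → ℝ) : Prop :=
  ∀ (i : Fin n) (h : Fin (m i) → Model d),
    ∑ B : Finset (Fin (m i)), (S.loc i B).toReal *
        ‖∑ j ∈ B, Matrix.toEuclideanCLM (𝕜 := ℝ) (CFC.sqrt (M i j)) (h j)‖ ^ 2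
      ≤ ∑ j, S.indexProb i j * v i j * ‖h j‖ ^ 2

end Sampling

/-- The state of the algorithm: local models, gradient tables, aggregation control variates. -/
structure State (d n : ℕ) (m : Fin n → ℕ) where
  x : Fin n → Model d
  J : (i : Fin n) → Fin (m i) → Model d
  Ψ : Fin n → Model d

section Algorithm

variable {d n : ℕ} {m : Fin n → ℕ}

/-- The gradient estimator of client `i` in an aggregation step. -/
def aggregationGrad (P : Problem d n m) (S : Sampling n m) (s : State d n m) (i : Fin n) :
    Model d :=
  (P.lam / ((n : ℝ) * S.p)) • (s.x i - average s.x) - ((S.p⁻¹ - 1) * (n : ℝ)⁻¹) • s.Ψ i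
    + (1 / total m) • ∑ j, s.J i j

/-- The gradient estimator of client `i` in a local step. -/
def localGrad (P : Problem d n m) (S : Sampling n m) (s : State d n m) (ω : Draw n m)
    (i : Fin n) : Model d :=
  (if i ∈ ω.active then
      (1 / (total m * (1 - S.p) * S.clientProb i)) •
        ∑ j ∈ ω.batch i, (S.indexProb i j)⁻¹ • (gradient (P.f i j) (s.x i) - s.J i j)
    else 0)
    + (1 / total m) • (∑ j, s.J i j) + (n : ℝ)⁻¹ • s.Ψ i

/-- One iteration of L2SGD++ (SAGA option) with stepsize `α`. -/
def step (P : Problem d n m) (S : Sampling n m) (α : ℝ) (s : State d n m) (ω : Draw n m) :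
    State d n m :=
  if ω.coin then
    { x := fun i => prox α (P.R i) (s.x i - α • aggregationGrad P S s i)
      J := s.J
      Ψ := fun i => P.lam • (s.x i - average s.x) }
  else
    { x := fun i => prox α (P.R i) (s.x i - α • localGrad P S s ω i)
      J := fun i j =>
        if i ∈ ω.active ∧ j ∈ ω.batch i then gradient (P.f i j) (s.x i) else s.J i j
      Ψ := s.Ψ }

/-- The initial state: models `x0` and zero control variates. -/
def initial (m : Fin n → ℕ) (x0 : Fin n → Model d) : State d n m :=
  { x := x0, J := fun _ _ => 0, Ψ := fun _ => 0 }

/-- The iterates of L2SGD++ (SAGA option) started at `x0`, for a given sequence of outcomes of the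
random choices. -/
def iterates (P : Problem d n m) (S : Sampling n m) (α : ℝ) (x0 : Fin n → Model d)
    (ω : ℕ → Draw n m) : ℕ → State d n m
  | 0 => initial m x0
  | k + 1 => step P S α (iterates P S α x0 ω k) (ω k)

/-- The stepsize
`min { min_{i,j} N (1-p) p_{i,j} p_i / (4 v_{i,j} + N μ / n), n p / (4 λ + μ) }`. -/
def stepsize (P : Problem d n m) (S : Sampling n m) (μ : ℝ)
    (v : (i : Fin n) → Fin (m i) → ℝ) : ℝ :=
  min (⨅ a : (i : Fin n) × Fin (m i),
      total m * (1 - S.p) * S.indexProb a.1 a.2 * S.clientProb a.1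
        / (4 * v a.1 a.2 + total m * (μ / n)))
    ((n : ℝ) * S.p / (4 * P.lam + μ))

/-- The factor in front of `log (1/ε)`:
`max { max_{i,j} (4 v_{i,j} n / N + μ) / (μ (1-p) p_{i,j} p_i), (4 λ + μ) / (p μ) }`. -/
def complexity (P : Problem d n m) (S : Sampling n m) (μ : ℝ)
    (v : (i : Fin n) → Fin (m i) → ℝ) : ℝ :=
  max (⨆ a : (i : Fin n) × Fin (m i),
      (4 * v a.1 a.2 * ((n : ℝ) / total m) + μ)
        / (μ * (1 - S.p) * S.indexProb a.1 a.2 * S.clientProb a.1))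
    ((4 * P.lam + μ) / (S.p * μ))

/-- The squared distance of the local models to `z`. -/
def distSq (z : Fin n → Model d) (s : State d n m) : ℝ := ∑ i, ‖s.x i - z i‖ ^ 2

/-- The Lyapunov function: squared distance of the models to `z` plus `α` times weighted squared
distances of the control variates to their values at `z`. (If `lam = 0` then all `Ψ` iterates
and the values `lam • _` vanish, and so does the last term.) -/
def lyapunov (P : Problem d n m) (S : Sampling n m)
    (M : (i : Fin n) → Fin (m i) → Matrix (Fin d) (Fin d) ℝ) (α : ℝ)
    (z : Fin n → Model d) (s : State d n m) : ℝ :=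
  distSq z s + α *
    ((∑ i, ∑ j, 1 / (2 * total m * (1 - S.p) * S.indexProb i j * S.clientProb i) *
        weightedSq (M i j)⁻¹ (s.J i j - gradient (P.f i j) (z i)))
      + 1 / (2 * (n : ℝ) * P.lam * S.p) * ∑ i, ‖s.Ψ i - P.lam • (z i - average z)‖ ^ 2)

end Algorithm

end

end L2SGD

/-!
The proof is a Lyapunov argument for a variance-reduced proximal gradient method.

Write `y = x - x⋆`, `a i j = ∇f i j (x i) - ∇f i j (x⋆ i)`, `w i j = J i j - ∇f i j (x⋆ i)`,
`u i = λ (y i - ȳ)` and `ψ i = Ψ i - λ (x⋆ i - x̄⋆)`. The minimizer `x⋆` exists because the objective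
is lower semicontinuous and grows quadratically (a proper closed convex function has a lower bound
of linear growth), and it satisfies a variational inequality. Combined with the one of the proximal
operator, this shows that a proximal step moves the models no further from `x⋆` than the distance
between the two underlying gradient steps (`Problem.IsMinimizer.sum_norm_prox_sub_sq_le`).

One unbiased estimator describes both kinds of steps: `blockEstimator` applied to data `(c, u)`
has mean `(1/n) u + (1/N) ∑ j, c j`, and the ESO inequality bounds its second moment
(`expect_norm_blockEstimator_sq_le`). The error `g - ∇F(x⋆)` of the gradient estimator is the
estimator with data `(a, u)` minus the centred estimator with data `(w, ψ)`
(`gradEstimator_sub_blockGrad`), so its second moment is at most twice the sum of the two second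
moments. Its mean is `∇F(x) - ∇F(x⋆)`, and the inner product of the latter with `y` is bounded
below by strong convexity, which yields the factor `1 - αμ/n`, and by cocoercivity of the gradients
in the norms given by `M⁻¹`, which pays for the terms in `a` and `u`
(`Problem.sum_inner_blockGrad_sub_ge`).

In expectation a step replaces a fraction of `w` by `a` and of `ψ` by `u`. The weights in the
Lyapunov function and the two bounds on the stepsize are such that all coefficients of the squared
norms of `a`, `u`, `w` and `ψ` cancel or have the right sign (`expect_lyapunov_step_le`). As an
iterate is a function of the earlier draws, which are finitely valued and independent of the
current one, the one-step estimate integrates to the geometric decay.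
-/

namespace L2SGD

open scoped MatrixOrder

/-! ### Elementary inequalities -/

/-- A first-order term dominates: if `t * A + t ^ 2 * K` is nonnegative for small `t > 0`, then so
is `A`. This replaces all differentiations along segments. -/
theorem nonneg_of_forall_mul_add_sq {A K : ℝ}
    (h : ∀ t : ℝ, 0 < t → t ≤ 1 → 0 ≤ t * A + t ^ 2 * K) : 0 ≤ A := by
  by_contra! hA
  have hden : 0 < |K| + |A| + 1 := by positivity
  have ht0 : 0 < |A| / (|K| + |A| + 1) := div_pos (abs_pos.2 hA.ne) hden
  have ht1 : |A| / (|K| + |A| + 1) ≤ 1 := by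
    rw [div_le_one hden]; linarith [abs_nonneg K]
  have h1 := h _ ht0 ht1
  set t := |A| / (|K| + |A| + 1) with ht
  have h2 : t * (|K| + |A| + 1) = |A| := by rw [ht]; field_simp
  have h3 : t * (A + t * K) < 0 := by
    refine mul_neg_of_pos_of_neg ht0 ?_
    rw [abs_of_neg hA] at h2
    have := le_abs_self K
    have h4 : t * K ≤ t * |K| := mul_le_mul_of_nonneg_left this ht0.le
    nlinarith
  nlinarith

theorem norm_sub_smul_sq {E : Type*} [NormedAddCommGroup E] [InnerProductSpace ℝ E] (t : ℝ)
    (a b : E) : ‖a - t • b‖ ^ 2 = ‖a‖ ^ 2 - 2 * t * inner ℝ a b + t ^ 2 * ‖b‖ ^ 2 := by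
  rw [norm_sub_sq_real, real_inner_smul_right, norm_smul, mul_pow, Real.norm_eq_abs, sq_abs]
  ring

theorem norm_add_smul_sq {E : Type*} [NormedAddCommGroup E] [InnerProductSpace ℝ E] (t : ℝ)
    (a b : E) : ‖a + t • b‖ ^ 2 = ‖a‖ ^ 2 + 2 * t * inner ℝ a b + t ^ 2 * ‖b‖ ^ 2 := by
  rw [norm_add_sq_real, real_inner_smul_right, norm_smul, mul_pow, Real.norm_eq_abs, sq_abs]
  ring

/-! ### Sums of extended reals -/

theorem coe_sum_ereal {ι : Type*} (s : Finset ι) (a : ι → ℝ) :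
    ((∑ i ∈ s, a i : ℝ) : EReal) = ∑ i ∈ s, (a i : EReal) := by
  classical
  induction s using Finset.induction_on with
  | empty => simp
  | insert i s hi ih => rw [Finset.sum_insert hi, Finset.sum_insert hi, EReal.coe_add, ih]

theorem sum_ereal_ne_bot {ι : Type*} (s : Finset ι) {a : ι → EReal} (h : ∀ i, a i ≠ ⊥) :
    ∑ i ∈ s, a i ≠ ⊥ := by
  classical
  induction s using Finset.induction_on with
  | empty => simp
  | insert i s hi ih =>
    rw [Finset.sum_insert hi]
    simp [EReal.add_eq_bot_iff, h i, ih]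

theorem ne_top_of_sum_ereal_ne_top {ι : Type*} {s : Finset ι} {a : ι → EReal} (h : ∀ i, a i ≠ ⊥)
    (hs : ∑ i ∈ s, a i ≠ ⊤) {i : ι} (hi : i ∈ s) : a i ≠ ⊤ := by
  classical
  rintro hai
  apply hs
  rw [← Finset.add_sum_erase s a hi, hai]
  exact EReal.top_add_of_ne_bot (sum_ereal_ne_bot _ h)

theorem sum_ereal_eq_coe {ι : Type*} (s : Finset ι) {a : ι → EReal} (h : ∀ i, a i ≠ ⊥)
    (h' : ∀ i, a i ≠ ⊤) : ∑ i ∈ s, a i = ((∑ i ∈ s, (a i).toReal : ℝ) : EReal) := by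
  rw [coe_sum_ereal]
  exact Finset.sum_congr rfl fun i _ => (EReal.coe_toReal (h' i) (h i)).symm

theorem lowerSemicontinuous_sum_ereal {X ι : Type*} [TopologicalSpace X] (s : Finset ι)
    {g : ι → X → EReal} (hg : ∀ i, LowerSemicontinuous (g i)) (hb : ∀ i x, g i x ≠ ⊥) :
    LowerSemicontinuous fun x => ∑ i ∈ s, g i x := by
  classical
  induction s using Finset.induction_on with
  | empty => simpa using lowerSemicontinuous_const
  | insert i s hi ih =>
    simp_rw [Finset.sum_insert hi]
    refine (hg i).add' ih fun x => EReal.continuousAt_add ?_ ?_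
    · exact Or.inr (sum_ereal_ne_bot s fun j => hb j x)
    · exact Or.inl (hb i x)

/-! ### Existence of minimizers -/

/-- A lower semicontinuous function with a quadratic lower bound attains its minimum. -/
theorem exists_forall_le_of_quadratic_growth {E : Type*} [NormedAddCommGroup E] [ProperSpace E]
    {G : E → EReal} (hG : LowerSemicontinuous G) {z₀ : E} (hz : G z₀ ≠ ⊤) {c C : ℝ} (hc : 0 < c)
    (hlow : ∀ z, ((c * ‖z - z₀‖ ^ 2 - C : ℝ) : EReal) ≤ G z) : ∃ u, ∀ y, G u ≤ G y := by
  have hbot : G z₀ ≠ ⊥ := fun h => by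
    have := hlow z₀
    rw [h, le_bot_iff] at this
    exact EReal.coe_ne_bot _ this
  set g := (G z₀).toReal with hg
  have hgz : G z₀ = (g : EReal) := (EReal.coe_toReal hz hbot).symm
  set ρ : ℝ := (|g| + |C|) / c + 1 with hρ
  have hρ1 : 1 ≤ ρ := by rw [hρ]; linarith [show 0 ≤ (|g| + |C|) / c by positivity]
  have hcρ : c * ρ = |g| + |C| + c := by rw [hρ]; field_simp
  obtain ⟨u, hu, humin⟩ := LowerSemicontinuousOn.exists_isMinOn (s := Metric.closedBall z₀ ρ)
    ⟨z₀, Metric.mem_closedBall_self (by linarith)⟩ (isCompact_closedBall z₀ ρ)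
    (hG.lowerSemicontinuousOn _)
  refine ⟨u, fun y => ?_⟩
  by_cases hy : y ∈ Metric.closedBall z₀ ρ
  · exact humin hy
  · have huz : G u ≤ G z₀ := humin (Metric.mem_closedBall_self (by linarith))
    refine huz.trans (le_trans ?_ (hlow y))
    rw [hgz, EReal.coe_le_coe_iff]
    rw [Metric.mem_closedBall, dist_eq_norm, not_le] at hy
    have h1 : c * ρ ≤ c * ‖y - z₀‖ ^ 2 := by
      refine mul_le_mul_of_nonneg_left ?_ hc.le
      nlinarith
    linarith [le_abs_self g, le_abs_self C]

variable {d n : ℕ} {m : Fin n → ℕ}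

namespace ProperClosedConvex

variable {r : Model d → EReal}

theorem coe_toReal (hr : ProperClosedConvex r) {z : Model d} (hz : r z ≠ ⊤) :
    ((r z).toReal : EReal) = r z :=
  EReal.coe_toReal hz (hr.ne_bot z)

theorem le_convexComb (hr : ProperClosedConvex r) {x y : Model d} (hx : r x ≠ ⊤) (hy : r y ≠ ⊤)
    {a b : ℝ} (ha : 0 ≤ a) (hb : 0 ≤ b) (hab : a + b = 1) :
    r (a • x + b • y) ≤ ((a * (r x).toReal + b * (r y).toReal : ℝ) : EReal) := by
  have h := hr.convex (x := (x, (r x).toReal)) (y := (y, (r y).toReal))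
    (by simp [hr.coe_toReal hx]) (by simp [hr.coe_toReal hy]) ha hb hab
  simpa using h

/-- A proper closed convex function is finite and convex along a segment of its domain. -/
theorem segment (hr : ProperClosedConvex r) {x y : Model d} (hx : r x ≠ ⊤) (hy : r y ≠ ⊤)
    {t : ℝ} (ht0 : 0 < t) (ht1 : t ≤ 1) :
    r (x + t • (y - x)) ≠ ⊤ ∧
      (r (x + t • (y - x))).toReal ≤ (r x).toReal + t * ((r y).toReal - (r x).toReal) := by
  have h := hr.le_convexComb hx hy (a := 1 - t) (b := t) (by linarith) ht0.le (by ring)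
  have e : (1 - t) • x + t • y = x + t • (y - x) := by module
  rw [e] at h
  have htop : r (x + t • (y - x)) ≠ ⊤ := ne_top_of_le_ne_top (EReal.coe_ne_top _) h
  refine ⟨htop, ?_⟩
  rw [← hr.coe_toReal htop, EReal.coe_le_coe_iff] at h
  linarith

/-- A proper closed convex function has a lower bound of linear growth: it is bounded below on the
unit ball around a point of its domain, and convexity propagates the bound outwards. -/
theorem exists_linear_lower_bound (hr : ProperClosedConvex r) {z₀ : Model d} (hz : r z₀ ≠ ⊤) :
    ∃ C : ℝ, ∀ z, ((-(C * (1 + ‖z - z₀‖)) : ℝ) : EReal) ≤ r z := by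
  obtain ⟨a, -, hmin⟩ := LowerSemicontinuousOn.exists_isMinOn (s := Metric.closedBall z₀ 1)
    ⟨z₀, Metric.mem_closedBall_self zero_le_one⟩ (isCompact_closedBall z₀ 1)
    (hr.closed.lowerSemicontinuousOn _)
  have haz : r a ≤ r z₀ := hmin (Metric.mem_closedBall_self zero_le_one)
  have hatop : r a ≠ ⊤ := ne_top_of_le_ne_top hz haz
  have hb := hr.coe_toReal hatop
  have hg := hr.coe_toReal hz
  set b := (r a).toReal
  set g := (r z₀).toReal
  refine ⟨|b| + |g|, fun z => ?_⟩
  by_cases hball : z ∈ Metric.closedBall z₀ 1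
  · refine le_trans ?_ (hmin hball)
    rw [← hb, EReal.coe_le_coe_iff]
    nlinarith [neg_abs_le b, abs_nonneg b, abs_nonneg g, norm_nonneg (z - z₀)]
  · by_cases htop : r z = ⊤
    · rw [htop]; exact le_top
    rw [Metric.mem_closedBall, dist_eq_norm, not_le] at hball
    set t := ‖z - z₀‖ with ht
    have ht0 : 0 < t := by linarith
    have hseg := hr.segment hz htop (t := t⁻¹) (by positivity) (inv_le_one_of_one_le₀ hball.le)
    have hmem : z₀ + t⁻¹ • (z - z₀) ∈ Metric.closedBall z₀ 1 := by
      rw [Metric.mem_closedBall, dist_eq_norm, add_sub_cancel_left, norm_smul, ← ht,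
        Real.norm_of_nonneg (by positivity), inv_mul_cancel₀ ht0.ne']
    have h1 : r a ≤ r (z₀ + t⁻¹ • (z - z₀)) := hmin hmem
    rw [← hb, ← hr.coe_toReal hseg.1, EReal.coe_le_coe_iff] at h1
    rw [← hr.coe_toReal htop, EReal.coe_le_coe_iff]
    have h2 := h1.trans hseg.2
    set q := (r z).toReal
    have h3 : t * b ≤ t * (g + t⁻¹ * (q - g)) := mul_le_mul_of_nonneg_left h2 ht0.le
    have h4 : t * (g + t⁻¹ * (q - g)) = t * g + (q - g) := by field_simp
    have h5 : g ≤ |g| := le_abs_self g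
    have h6 : -|b| ≤ b := neg_abs_le b
    nlinarith [abs_nonneg b, abs_nonneg g, neg_abs_le g]

end ProperClosedConvex

/-- A continuous function of quadratic growth plus a separable proper closed convex function
attains its minimum. -/
theorem exists_isMin_add_sum {ι : Type*} [Fintype ι] {r : ι → Model d → EReal}
    (hr : ∀ i, ProperClosedConvex (r i)) {z₀ : ι → Model d} (hz : ∀ i, r i (z₀ i) ≠ ⊤)
    {φ : (ι → Model d) → ℝ} (hφ : Continuous φ) {c : ℝ} (hc : 0 < c) (B : ι → ℝ)
    (hlow : ∀ x, ∑ i, (c * ‖x i - z₀ i‖ ^ 2 - B i * (1 + ‖x i - z₀ i‖)) ≤ φ x) :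
    ∃ u : ι → Model d, ∀ y : ι → Model d,
      (φ u : EReal) + ∑ i, r i (u i) ≤ (φ y : EReal) + ∑ i, r i (y i) := by
  choose C hC using fun i => (hr i).exists_linear_lower_bound (hz i)
  set D : ι → ℝ := fun i => |B i + C i| with hD
  refine exists_forall_le_of_quadratic_growth (G := fun x => (φ x : EReal) + ∑ i, r i (x i))
    (z₀ := z₀) (c := c / 2) (C := ∑ i, (D i + D i ^ 2 / (2 * c))) ?_ ?_ (by positivity) ?_
  · refine LowerSemicontinuous.add' ?_ (lowerSemicontinuous_sum_ereal _ (fun i => ?_)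
      fun i x => (hr i).ne_bot _) fun x => EReal.continuousAt_add ?_ ?_
    · exact (continuous_coe_real_ereal.comp hφ).lowerSemicontinuous
    · exact (hr i).closed.comp (continuous_apply i)
    · exact Or.inl (EReal.coe_ne_top _)
    · exact Or.inl (EReal.coe_ne_bot _)
  · rw [sum_ereal_eq_coe _ (fun i => (hr i).ne_bot _) hz, ← EReal.coe_add]
    exact EReal.coe_ne_top _
  · intro x
    have h1 : ((∑ i, -(C i * (1 + ‖x i - z₀ i‖)) : ℝ) : EReal) ≤ ∑ i, r i (x i) := by
      rw [coe_sum_ereal]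
      exact Finset.sum_le_sum fun i _ => hC i (x i)
    refine le_trans ?_ (add_le_add (EReal.coe_le_coe_iff.2 (hlow x)) h1)
    rw [← EReal.coe_add, EReal.coe_le_coe_iff, ← Finset.sum_add_distrib]
    have h2 : ‖x - z₀‖ ^ 2 ≤ ∑ i, ‖x i - z₀ i‖ ^ 2 := by
      rcases isEmpty_or_nonempty ι with hι | hι
      · simp [Subsingleton.elim x z₀]
      · obtain ⟨i, hi⟩ := Finite.exists_max fun i => ‖x i - z₀ i‖
        have : ‖x - z₀‖ ≤ ‖x i - z₀ i‖ := (pi_norm_le_iff_of_nonneg (norm_nonneg _)).2 hi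
        refine (pow_le_pow_left₀ (norm_nonneg _) this 2).trans ?_
        exact Finset.single_le_sum (f := fun i => ‖x i - z₀ i‖ ^ 2) (fun j _ => by positivity)
          (Finset.mem_univ i)
    have h3 : c / 2 * ‖x - z₀‖ ^ 2 ≤ ∑ i, c / 2 * ‖x i - z₀ i‖ ^ 2 := by
      rw [← Finset.mul_sum]
      exact mul_le_mul_of_nonneg_left h2 (by positivity)
    have h4 : ∑ i, c / 2 * ‖x i - z₀ i‖ ^ 2 - ∑ i, (D i + D i ^ 2 / (2 * c)) ≤
        ∑ i, (c * ‖x i - z₀ i‖ ^ 2 - B i * (1 + ‖x i - z₀ i‖) +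
          -(C i * (1 + ‖x i - z₀ i‖))) := by
      rw [← Finset.sum_sub_distrib]
      refine Finset.sum_le_sum fun i _ => ?_
      have h5 : B i + C i ≤ D i := le_abs_self _
      have h6 : (B i + C i) * (1 + ‖x i - z₀ i‖) ≤ D i * (1 + ‖x i - z₀ i‖) :=
        mul_le_mul_of_nonneg_right h5 (by positivity)
      have h7 : D i * ‖x i - z₀ i‖ ≤ c / 2 * ‖x i - z₀ i‖ ^ 2 + D i ^ 2 / (2 * c) := by
        have e : c / 2 * ‖x i - z₀ i‖ ^ 2 + D i ^ 2 / (2 * c) - D i * ‖x i - z₀ i‖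
            = (c * ‖x i - z₀ i‖ - D i) ^ 2 / (2 * c) := by field_simp; ring
        have : 0 ≤ (c * ‖x i - z₀ i‖ - D i) ^ 2 / (2 * c) := by positivity
        linarith
      linarith
    linarith

/-! ### The proximal operator -/

theorem exists_isProx {α : ℝ} (hα : 0 < α) {r : Model d → EReal} (hr : ProperClosedConvex r)
    (z : Model d) : ∃ u, IsProx α r z u := by
  obtain ⟨z₀, hz₀⟩ := hr.exists_ne_top
  -- minimize `r + (1 / (2 α)) ‖· - z‖²`, which avoids multiplying extended reals by `α`
  obtain ⟨u, hu⟩ := exists_isMin_add_sum (ι := Unit) (r := fun _ => r) (fun _ => hr)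
    (z₀ := fun _ => z₀) (fun _ => hz₀)
    (φ := fun x => 1 / (2 * α) * ‖x () - z‖ ^ 2) (by fun_prop) (c := 1 / (2 * α))
    (by positivity) (fun _ => 1 / α * ‖z₀ - z‖) (fun x => by
      simp only [Finset.univ_unique, PUnit.default_eq_unit, Finset.sum_singleton]
      have h1 : x () - z = (x () - z₀) + (z₀ - z) := by abel
      have h2 := norm_add_sq_real (x () - z₀) (z₀ - z)
      rw [← h1] at h2
      have h3 := neg_abs_le (inner ℝ (x () - z₀) (z₀ - z))
      have h4 := abs_real_inner_le_norm (x () - z₀) (z₀ - z)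
      rw [h2]
      have e : 1 / α = 2 * (1 / (2 * α)) := by field_simp
      rw [e]
      have h5 : 0 < 1 / (2 * α) := by positivity
      set s := 1 / (2 * α)
      have h6 : -(‖x () - z₀‖ * ‖z₀ - z‖) ≤ inner ℝ (x () - z₀) (z₀ - z) := by linarith
      have h7 := mul_le_mul_of_nonneg_left h6 h5.le
      have h8 : 0 ≤ s * ‖z₀ - z‖ := by positivity
      have h9 : 0 ≤ s * ‖z₀ - z‖ ^ 2 := by positivity
      nlinarith)
  refine ⟨u (), fun y => ?_⟩
  have hu0 := hu fun _ => z₀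
  have huy := hu fun _ => y
  simp only [Finset.univ_unique, PUnit.default_eq_unit, Finset.sum_singleton] at hu0 huy
  have hutop : r (u ()) ≠ ⊤ := by
    intro h
    rw [h, EReal.coe_add_top, top_le_iff, ← hr.coe_toReal hz₀, ← EReal.coe_add] at hu0
    exact EReal.coe_ne_top _ hu0
  by_cases hy : r y = ⊤
  · rw [hy, EReal.coe_mul_top_of_pos hα, EReal.top_add_coe]
    exact le_top
  rw [← hr.coe_toReal hutop, ← hr.coe_toReal hy] at huy ⊢
  rw [← EReal.coe_add, ← EReal.coe_add, EReal.coe_le_coe_iff] at huy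
  rw [← EReal.coe_mul, ← EReal.coe_mul, ← EReal.coe_add, ← EReal.coe_add, EReal.coe_le_coe_iff]
  have h := mul_le_mul_of_nonneg_left huy hα.le
  have e : ∀ a b : ℝ, α * (1 / (2 * α) * a + b) = α * b + 1 / 2 * a := fun a b => by
    field_simp; ring
  rwa [e, e] at h

theorem prox_isProx {α : ℝ} (hα : 0 < α) {r : Model d → EReal} (hr : ProperClosedConvex r)
    (z : Model d) : IsProx α r z (prox α r z) :=
  Classical.epsilon_spec (exists_isProx hα hr z)

theorem IsProx.ne_top {α : ℝ} (hα : 0 < α) {r : Model d → EReal} (hr : ProperClosedConvex r)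
    {z u : Model d} (h : IsProx α r z u) : r u ≠ ⊤ := by
  obtain ⟨z₀, hz₀⟩ := hr.exists_ne_top
  intro hu
  have h0 := h z₀
  rw [hu, EReal.coe_mul_top_of_pos hα, EReal.top_add_coe, top_le_iff, ← hr.coe_toReal hz₀,
    ← EReal.coe_mul, ← EReal.coe_add] at h0
  exact EReal.coe_ne_top _ h0

/-- The variational inequality: `z - u` is a subgradient of `α r` at `u = prox_{α r}(z)`. -/
theorem IsProx.variational {α : ℝ} (hα : 0 < α) {r : Model d → EReal}
    (hr : ProperClosedConvex r) {z u : Model d} (h : IsProx α r z u) {y : Model d}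
    (hy : r y ≠ ⊤) :
    α * (r u).toReal + inner ℝ (z - u) (y - u) ≤ α * (r y).toReal := by
  have hu := h.ne_top hα hr
  suffices 0 ≤ α * ((r y).toReal - (r u).toReal) + inner ℝ (u - z) (y - u) by
    rw [← neg_sub u z, inner_neg_left]; linarith
  refine nonneg_of_forall_mul_add_sq (K := 1 / 2 * ‖y - u‖ ^ 2) fun t ht0 ht1 => ?_
  obtain ⟨hs, hle⟩ := hr.segment hu hy ht0 ht1
  have h1 := h (u + t • (y - u))
  rw [← hr.coe_toReal hs, ← hr.coe_toReal hu, ← EReal.coe_mul, ← EReal.coe_mul, ← EReal.coe_add,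
    ← EReal.coe_add, EReal.coe_le_coe_iff] at h1
  have e : u + t • (y - u) - z = (u - z) + t • (y - u) := by abel
  rw [e, norm_add_smul_sq] at h1
  have h2 := mul_le_mul_of_nonneg_left hle hα.le
  linarith

/-! ### Smooth convex functions -/

theorem weightedSq_smul (A : Matrix (Fin d) (Fin d) ℝ) (t : ℝ) (w : Model d) :
    weightedSq A (t • w) = t ^ 2 * weightedSq A w := by
  simp only [weightedSq, map_smul, real_inner_smul_left, real_inner_smul_right]
  ring

theorem toEuclideanCLM_mul_apply (A B : Matrix (Fin d) (Fin d) ℝ) (w : Model d) :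
    Matrix.toEuclideanCLM (𝕜 := ℝ) A (Matrix.toEuclideanCLM (𝕜 := ℝ) B w)
      = Matrix.toEuclideanCLM (𝕜 := ℝ) (A * B) w := by
  rw [map_mul]; rfl

theorem toEuclideanCLM_one_apply (w : Model d) :
    Matrix.toEuclideanCLM (𝕜 := ℝ) (1 : Matrix (Fin d) (Fin d) ℝ) w = w := by
  rw [map_one]; rfl

theorem inner_toEuclideanCLM_left {A : Matrix (Fin d) (Fin d) ℝ} (hA : A.IsHermitian)
    (x y : Model d) :
    inner ℝ (Matrix.toEuclideanCLM (𝕜 := ℝ) A x) y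
      = inner ℝ x (Matrix.toEuclideanCLM (𝕜 := ℝ) A y) := by
  have h : IsSelfAdjoint (Matrix.toEuclideanCLM (𝕜 := ℝ) A) := hA.isSelfAdjoint.map _
  exact h.isSymmetric x y

theorem mul_inv_cancel_of_posDef {A : Matrix (Fin d) (Fin d) ℝ} (hA : A.PosDef) :
    A * A⁻¹ = 1 :=
  Matrix.mul_nonsing_inv A ((Matrix.isUnit_iff_isUnit_det A).1 hA.isUnit)

/-- Every vector `c` is of the form `A^{1/2} h` with `‖h‖² = ‖c‖²_{A⁻¹}`. -/
theorem exists_sqrt_preimage {A : Matrix (Fin d) (Fin d) ℝ} (hA : A.PosDef) (c : Model d) :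
    ∃ h : Model d, Matrix.toEuclideanCLM (𝕜 := ℝ) (CFC.sqrt A) h = c ∧
      ‖h‖ ^ 2 = weightedSq A⁻¹ c := by
  have hs : CFC.sqrt A * CFC.sqrt A = A := CFC.sqrt_mul_sqrt_self A hA.posSemidef.nonneg
  have hh : (CFC.sqrt A).IsHermitian := (CFC.sqrt_nonneg A).isSelfAdjoint
  have key : Matrix.toEuclideanCLM (𝕜 := ℝ) (CFC.sqrt A)
      (Matrix.toEuclideanCLM (𝕜 := ℝ) (CFC.sqrt A * A⁻¹) c) = c := by
    rw [toEuclideanCLM_mul_apply, ← mul_assoc, hs, mul_inv_cancel_of_posDef hA,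
      toEuclideanCLM_one_apply]
  refine ⟨Matrix.toEuclideanCLM (𝕜 := ℝ) (CFC.sqrt A * A⁻¹) c, key, ?_⟩
  rw [← real_inner_self_eq_norm_sq]
  nth_rw 1 [← toEuclideanCLM_mul_apply]
  rw [inner_toEuclideanCLM_left hh, key, weightedSq, real_inner_comm]

theorem weightedSq_inv_nonneg {A : Matrix (Fin d) (Fin d) ℝ} (hA : A.PosDef) (c : Model d) :
    0 ≤ weightedSq A⁻¹ c := by
  obtain ⟨h, -, hh⟩ := exists_sqrt_preimage hA c
  rw [← hh]; positivity

/-- Cocoercivity of the gradient: the Bregman divergence of a convex `A`-smooth function dominates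
half the squared gradient difference in the norm of `A⁻¹`. -/
theorem ConvexMatrixSmooth.cocoercive {A : Matrix (Fin d) (Fin d) ℝ} (hA : A.PosDef)
    {φ : Model d → ℝ} (hφ : ConvexMatrixSmooth A φ) (x y : Model d) :
    φ y + inner ℝ (gradient φ y) (x - y) + 1 / 2 * weightedSq A⁻¹ (gradient φ x - gradient φ y)
      ≤ φ x := by
  set a := gradient φ x - gradient φ y with ha
  set b := Matrix.toEuclideanCLM (𝕜 := ℝ) A⁻¹ a with hb
  -- compare both models at the minimizer `x - A⁻¹ a` of the upper model minus the lower one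
  have h1 := (hφ.2 (x - b) x).2
  have h2 := (hφ.2 (x - b) y).1
  have e1 : x - b - x = -b := by abel
  have e2 : x - b - y = (x - y) - b := by abel
  have e3 : weightedSq A (-b) = inner ℝ a b := by
    simp only [weightedSq, map_neg, inner_neg_neg]
    rw [hb, toEuclideanCLM_mul_apply, mul_inv_cancel_of_posDef hA, toEuclideanCLM_one_apply,
      real_inner_comm]
  have e4 : weightedSq A⁻¹ a = inner ℝ a b := rfl
  have e5 : inner ℝ a b = inner ℝ (gradient φ x) b - inner ℝ (gradient φ y) b := by
    rw [ha, inner_sub_left]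
  rw [e1, e3, inner_neg_right] at h1
  rw [e2, inner_sub_right] at h2
  rw [e4]
  linarith

/-! ### The optimization problem -/

theorem average_add_smul (t : ℝ) (x y : Fin n → Model d) :
    average (x + t • y) = average x + t • average y := by
  simp only [average, Pi.add_apply, Pi.smul_apply, Finset.sum_add_distrib, ← Finset.smul_sum,
    smul_add]
  rw [smul_comm]

theorem average_sub (x y : Fin n → Model d) : average (x - y) = average x - average y := by
  simp only [average, Pi.sub_apply, Finset.sum_sub_distrib, smul_sub]

theorem sum_sub_average (hn : 0 < n) (x : Fin n → Model d) : ∑ i, (x i - average x) = 0 := by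
  have : (n : ℝ) ≠ 0 := by positivity
  rw [Finset.sum_sub_distrib, Finset.sum_const, Finset.card_univ, Fintype.card_fin, average,
    ← Nat.cast_smul_eq_nsmul ℝ, smul_smul, mul_inv_cancel₀ this, one_smul, sub_self]

/-- Deviations from the average are orthogonal to constant families. -/
theorem sum_inner_sub_average (hn : 0 < n) (x y : Fin n → Model d) :
    ∑ i, inner ℝ (x i - average x) (y i - average y) = ∑ i, inner ℝ (x i - average x) (y i) := by
  simp only [inner_sub_right (_ : Model d) (y _) (average y)]
  rw [Finset.sum_sub_distrib, ← sum_inner, sum_sub_average hn, inner_zero_left, sub_zero]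

theorem total_pos (hn : 0 < n) (hm : ∀ i, 0 < m i) : 0 < total m :=
  Finset.sum_pos (fun i _ => by exact_mod_cast hm i) ⟨⟨0, hn⟩, Finset.mem_univ _⟩

namespace Problem

variable {P : Problem d n m} {M : (i : Fin n) → Fin (m i) → Matrix (Fin d) (Fin d) ℝ}

/-- The `i`-th block of the gradient of the smooth part of the objective. -/
noncomputable def blockGrad (P : Problem d n m) (x : Fin n → Model d) (i : Fin n) : Model d :=
  (1 / total m) • ∑ j, gradient (P.f i j) (x i) + (P.lam / n) • (x i - average x)

/-- First-order characterization of the strong convexity of the local objectives. -/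
theorem localObj_strongConvex (hf : ∀ i j, ConvexMatrixSmooth (M i j) (P.f i j)) {μ : ℝ}
    (hsc : ∀ i, StrongConvexOn Set.univ μ (P.localObj i)) (i : Fin n) (x y : Model d) :
    P.localObj i x + inner ℝ (((n : ℝ) / total m) • ∑ j, gradient (P.f i j) x) (y - x)
      + μ / 2 * ‖y - x‖ ^ 2 ≤ P.localObj i y := by
  set G := ((n : ℝ) / total m) • ∑ j, gradient (P.f i j) x with hG
  have hT : 0 ≤ (n : ℝ) / total m := by
    refine div_nonneg (Nat.cast_nonneg _) (Finset.sum_nonneg fun i _ => Nat.cast_nonneg _)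
  have hfirst : ∀ z, P.localObj i x + inner ℝ G (z - x) ≤ P.localObj i z := by
    intro z
    rw [localObj, localObj, hG, real_inner_smul_left, sum_inner, ← mul_add,
      ← Finset.sum_add_distrib]
    exact mul_le_mul_of_nonneg_left (Finset.sum_le_sum fun j _ => ((hf i j).2 z x).1) hT
  suffices 0 ≤ P.localObj i y - (P.localObj i x + inner ℝ G (y - x) + μ / 2 * ‖y - x‖ ^ 2) by
    linarith
  refine nonneg_of_forall_mul_add_sq (K := μ / 2 * ‖y - x‖ ^ 2) fun t ht0 ht1 => ?_
  obtain ⟨-, hc⟩ := hsc i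
  have h := hc (Set.mem_univ x) (Set.mem_univ y) (a := 1 - t) (b := t) (by linarith)
    ht0.le (by ring)
  have e : (1 - t) • x + t • y = x + t • (y - x) := by module
  have h1 := hfirst (x + t • (y - x))
  rw [add_sub_cancel_left, real_inner_smul_right] at h1
  rw [e, norm_sub_rev] at h
  simp only [smul_eq_mul] at h
  linarith

/-- Strong monotonicity of the local gradients, with an additional cocoercive term. -/
theorem sum_inner_gradient_sub_ge (hn : 0 < n) (hm : ∀ i, 0 < m i) (hM : ∀ i j, (M i j).PosDef)
    (hf : ∀ i j, ConvexMatrixSmooth (M i j) (P.f i j)) {μ : ℝ}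
    (hsc : ∀ i, StrongConvexOn Set.univ μ (P.localObj i)) (i : Fin n) (x z : Model d) :
    μ / (2 * n) * ‖x - z‖ ^ 2 + 1 / (2 * total m) *
        ∑ j, weightedSq (M i j)⁻¹ (gradient (P.f i j) x - gradient (P.f i j) z)
      ≤ 1 / total m * ∑ j, inner ℝ (x - z) (gradient (P.f i j) x - gradient (P.f i j) z) := by
  have hN := total_pos hn hm
  have hn' : (0 : ℝ) < n := by exact_mod_cast hn
  have h1 := localObj_strongConvex hf hsc i x z
  rw [localObj, localObj, real_inner_smul_left, sum_inner] at h1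
  have h2 : ∑ j, (P.f i j z + inner ℝ (gradient (P.f i j) z) (x - z) + 1 / 2 *
      weightedSq (M i j)⁻¹ (gradient (P.f i j) x - gradient (P.f i j) z)) ≤ ∑ j, P.f i j x :=
    Finset.sum_le_sum fun j _ => (hf i j).cocoercive (hM i j) x z
  rw [Finset.sum_add_distrib, Finset.sum_add_distrib, ← Finset.mul_sum] at h2
  have e : ∀ j, inner ℝ (x - z) (gradient (P.f i j) x - gradient (P.f i j) z)
      = -inner ℝ (gradient (P.f i j) x) (z - x) - inner ℝ (gradient (P.f i j) z) (x - z) := by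
    intro j
    rw [← neg_sub x z, inner_neg_right, inner_sub_right, real_inner_comm (x - z),
      real_inner_comm (x - z)]
    ring
  simp only [e, Finset.sum_sub_distrib, Finset.sum_neg_distrib]
  rw [norm_sub_rev] at h1
  set a := ∑ j, P.f i j x
  set b := ∑ j, P.f i j z
  set s := ∑ j, inner ℝ (gradient (P.f i j) x) (z - x)
  set s' := ∑ j, inner ℝ (gradient (P.f i j) z) (x - z)
  set q := ∑ j, weightedSq (M i j)⁻¹ (gradient (P.f i j) x - gradient (P.f i j) z)
  have h3 : μ / 2 * ‖x - z‖ ^ 2 ≤ (n : ℝ) / total m * (b - a - s) := by linarith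
  have h4 : μ / (2 * n) * ‖x - z‖ ^ 2 ≤ 1 / total m * (b - a - s) := by
    have := mul_le_mul_of_nonneg_left h3 (inv_nonneg.2 hn'.le)
    calc μ / (2 * n) * ‖x - z‖ ^ 2 = (n : ℝ)⁻¹ * (μ / 2 * ‖x - z‖ ^ 2) := by ring
      _ ≤ _ := this
      _ = 1 / total m * (b - a - s) := by field_simp
  have h5 : 1 / total m * (s' + 1 / 2 * q) ≤ 1 / total m * (a - b) :=
    mul_le_mul_of_nonneg_left (by linarith) (by positivity)
  have e6 : 1 / (2 * total m) * q = 1 / total m * (1 / 2 * q) := by ring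
  rw [e6]
  linarith

/-- The quadratic upper model of the smooth part along a line. -/
theorem exists_smoothPart_upper (hn : 0 < n) (hm : ∀ i, 0 < m i)
    (hf : ∀ i j, ConvexMatrixSmooth (M i j) (P.f i j)) (x w : Fin n → Model d) :
    ∃ K : ℝ, ∀ t : ℝ, P.smoothPart (x + t • w)
      ≤ P.smoothPart x + t * ∑ i, inner ℝ (P.blockGrad x i) (w i) + t ^ 2 * K := by
  have hN := total_pos hn hm
  refine ⟨1 / total m * ∑ i, ∑ j, 1 / 2 * weightedSq (M i j) (w i)
    + P.lam * (1 / (2 * (n : ℝ)) * ∑ i, ‖w i - average w‖ ^ 2), fun t => ?_⟩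
  have h1 : ∑ i, ∑ j, P.f i j ((x + t • w) i) ≤ ∑ i, ∑ j, P.f i j (x i)
      + t * ∑ i, ∑ j, inner ℝ (gradient (P.f i j) (x i)) (w i)
      + t ^ 2 * ∑ i, ∑ j, 1 / 2 * weightedSq (M i j) (w i) := by
    simp only [Finset.mul_sum, ← Finset.sum_add_distrib]
    refine Finset.sum_le_sum fun i _ => Finset.sum_le_sum fun j _ => ?_
    have h := ((hf i j).2 ((x + t • w) i) (x i)).2
    rw [Pi.add_apply, Pi.smul_apply, add_sub_cancel_left, real_inner_smul_right,
      weightedSq_smul] at h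
    rw [Pi.add_apply, Pi.smul_apply]
    linarith
  have h2 : ∑ i, ‖(x + t • w) i - average (x + t • w)‖ ^ 2 = ∑ i, ‖x i - average x‖ ^ 2
      + 2 * t * ∑ i, inner ℝ (x i - average x) (w i) + t ^ 2 * ∑ i, ‖w i - average w‖ ^ 2 := by
    rw [← sum_inner_sub_average hn]
    simp only [Finset.mul_sum, ← Finset.sum_add_distrib]
    refine Finset.sum_congr rfl fun i _ => ?_
    rw [← norm_add_smul_sq, average_add_smul, Pi.add_apply, Pi.smul_apply]
    congr 2
    module
  have h3 : ∑ i, inner ℝ (P.blockGrad x i) (w i)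
      = 1 / total m * ∑ i, ∑ j, inner ℝ (gradient (P.f i j) (x i)) (w i)
        + P.lam / n * ∑ i, inner ℝ (x i - average x) (w i) := by
    simp only [blockGrad, inner_add_left, real_inner_smul_left, sum_inner,
      Finset.sum_add_distrib, Finset.mul_sum]
  have h4 := mul_le_mul_of_nonneg_left h1 (one_div_nonneg.2 hN.le)
  have e : ∀ s : ℝ, P.lam / n * s = P.lam * (1 / (2 * (n : ℝ)) * (2 * s)) := fun s => by
    have : (n : ℝ) ≠ 0 := by positivity
    field_simp
  rw [smoothPart, smoothPart, h2, h3, e]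
  linarith

theorem continuous_smoothPart (hf : ∀ i j, ConvexMatrixSmooth (M i j) (P.f i j)) :
    Continuous P.smoothPart := by
  have h : ∀ i j, Continuous (P.f i j) := fun i j => (hf i j).1.continuous
  unfold smoothPart average
  fun_prop

theorem isMinimizer_ne_top (hR : ∀ i, ProperClosedConvex (P.R i)) {x : Fin n → Model d}
    (hx : P.IsMinimizer x) (i : Fin n) : P.R i (x i) ≠ ⊤ := by
  choose z hz using fun i => (hR i).exists_ne_top
  have h := hx z
  rw [objective, objective, sum_ereal_eq_coe _ (fun i => (hR i).ne_bot _) hz,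
    ← EReal.coe_add] at h
  refine ne_top_of_sum_ereal_ne_top (s := Finset.univ) (a := fun i => P.R i (x i))
    (fun i => (hR i).ne_bot _) (fun htop => ?_) (Finset.mem_univ i)
  rw [htop, EReal.coe_add_top, top_le_iff] at h
  exact EReal.coe_ne_top _ h

/-- The objective attains its minimum, because it grows quadratically. -/
theorem exists_isMinimizer (hn : 0 < n) (hlam : 0 ≤ P.lam)
    (hf : ∀ i j, ConvexMatrixSmooth (M i j) (P.f i j)) {μ : ℝ} (hμ : 0 < μ)
    (hsc : ∀ i, StrongConvexOn Set.univ μ (P.localObj i))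
    (hR : ∀ i, ProperClosedConvex (P.R i)) : ∃ x, P.IsMinimizer x := by
  have hn' : (0 : ℝ) < n := by exact_mod_cast hn
  choose z hz using fun i => (hR i).exists_ne_top
  set G : Fin n → Model d := fun i => ((n : ℝ) / total m) • ∑ j, gradient (P.f i j) (z i) with hG
  refine exists_isMin_add_sum hR hz (continuous_smoothPart hf) (c := μ / (2 * n)) (by positivity)
    (fun i => 1 / n * (|P.localObj i (z i)| + ‖G i‖)) fun x => ?_
  have h1 : ∑ i, 1 / (n : ℝ) * P.localObj i (x i) ≤ P.smoothPart x := by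
    have e : ∑ i, 1 / (n : ℝ) * P.localObj i (x i) = 1 / total m * ∑ i, ∑ j, P.f i j (x i) := by
      rw [Finset.mul_sum]
      refine Finset.sum_congr rfl fun i _ => ?_
      rw [localObj]; field_simp
    rw [e, smoothPart]
    have : 0 ≤ P.lam * (1 / (2 * (n : ℝ)) * ∑ i, ‖x i - average x‖ ^ 2) := by positivity
    linarith
  refine le_trans (Finset.sum_le_sum fun i _ => ?_) h1
  have h2 := localObj_strongConvex hf hsc i (z i) (x i)
  have h3 := abs_le.1 (abs_real_inner_le_norm (G i) (x i - z i))
  have h4 : μ / 2 * ‖x i - z i‖ ^ 2 - (|P.localObj i (z i)| + ‖G i‖) * (1 + ‖x i - z i‖)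
      ≤ P.localObj i (x i) := by
    have h5 := neg_abs_le (P.localObj i (z i))
    have h6 : 0 ≤ |P.localObj i (z i)| * ‖x i - z i‖ := by positivity
    nlinarith [norm_nonneg (G i), h3.1]
  have h7 := mul_le_mul_of_nonneg_left h4 (one_div_nonneg.2 hn'.le)
  refine le_trans (le_of_eq ?_) h7
  field_simp

/-- First-order optimality: minus the gradient of the smooth part is a subgradient of the
regularizer at a minimizer. -/
theorem IsMinimizer.variational (hn : 0 < n) (hm : ∀ i, 0 < m i)
    (hf : ∀ i j, ConvexMatrixSmooth (M i j) (P.f i j))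
    (hR : ∀ i, ProperClosedConvex (P.R i)) {x : Fin n → Model d} (hx : P.IsMinimizer x)
    {y : Fin n → Model d} (hy : ∀ i, P.R i (y i) ≠ ⊤) :
    ∑ i, (P.R i (x i)).toReal
      ≤ ∑ i, (P.R i (y i)).toReal + ∑ i, inner ℝ (P.blockGrad x i) (y i - x i) := by
  have hxt := isMinimizer_ne_top hR hx
  obtain ⟨K, hK⟩ := exists_smoothPart_upper hn hm hf x (y - x)
  suffices 0 ≤ ∑ i, ((P.R i (y i)).toReal - (P.R i (x i)).toReal)
      + ∑ i, inner ℝ (P.blockGrad x i) (y i - x i) by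
    rw [Finset.sum_sub_distrib] at this; linarith
  refine nonneg_of_forall_mul_add_sq (K := K) fun t ht0 ht1 => ?_
  have hseg := fun i => (hR i).segment (hxt i) (hy i) ht0 ht1
  have h := hx (x + t • (y - x))
  rw [objective, objective, sum_ereal_eq_coe _ (fun i => (hR i).ne_bot _) hxt,
    sum_ereal_eq_coe _ (a := fun i => P.R i ((x + t • (y - x)) i)) (fun i => (hR i).ne_bot _)
      fun i => (hseg i).1, ← EReal.coe_add,
    ← EReal.coe_add, EReal.coe_le_coe_iff] at h
  have h1 := Finset.sum_le_sum fun i (_ : i ∈ Finset.univ) => (hseg i).2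
  rw [Finset.sum_add_distrib, ← Finset.mul_sum] at h1
  have h2 := hK t
  simp only [Pi.add_apply, Pi.smul_apply, Pi.sub_apply] at h h2
  linarith

theorem blockGrad_sub (x z : Fin n → Model d) (i : Fin n) :
    P.blockGrad x i - P.blockGrad z i
      = (1 / total m) • ∑ j, (gradient (P.f i j) (x i) - gradient (P.f i j) (z i))
        + (P.lam / n) • ((x - z) i - average (x - z)) := by
  rw [blockGrad, blockGrad, average_sub, Finset.sum_sub_distrib, Pi.sub_apply]
  module

/-- The gradient of the smooth part is strongly monotone, with additional cocoercive terms for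
the losses and for the penalty. -/
theorem sum_inner_blockGrad_sub_ge (hn : 0 < n) (hm : ∀ i, 0 < m i)
    (hM : ∀ i j, (M i j).PosDef) (hf : ∀ i j, ConvexMatrixSmooth (M i j) (P.f i j)) {μ : ℝ}
    (hsc : ∀ i, StrongConvexOn Set.univ μ (P.localObj i)) (x z : Fin n → Model d) :
    μ / (2 * n) * ∑ i, ‖x i - z i‖ ^ 2 + 1 / (2 * total m) *
        ∑ i, ∑ j, weightedSq (M i j)⁻¹ (gradient (P.f i j) (x i) - gradient (P.f i j) (z i))
        + P.lam / n * ∑ i, ‖(x - z) i - average (x - z)‖ ^ 2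
      ≤ ∑ i, inner ℝ (x i - z i) (P.blockGrad x i - P.blockGrad z i) := by
  have h1 := Finset.sum_le_sum fun i (_ : i ∈ Finset.univ) =>
    sum_inner_gradient_sub_ge hn hm hM hf hsc i (x i) (z i)
  have h2 := sum_inner_sub_average hn (x - z) (x - z)
  simp only [real_inner_self_eq_norm_sq] at h2
  rw [h2]
  simp only [blockGrad_sub, inner_add_right, real_inner_smul_right, inner_sum,
    Finset.sum_add_distrib, ← Finset.mul_sum] at h1 ⊢
  have e : ∑ i, inner ℝ ((x - z) i - average (x - z)) ((x - z) i)
      = ∑ i, inner ℝ (x i - z i) ((x - z) i - average (x - z)) :=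
    Finset.sum_congr rfl fun i _ => real_inner_comm _ _
  rw [e]
  linarith

theorem isMinimizer_unique (hn : 0 < n) (hm : ∀ i, 0 < m i) (hlam : 0 ≤ P.lam)
    (hM : ∀ i j, (M i j).PosDef) (hf : ∀ i j, ConvexMatrixSmooth (M i j) (P.f i j))
    {μ : ℝ} (hμ : 0 < μ) (hsc : ∀ i, StrongConvexOn Set.univ μ (P.localObj i))
    (hR : ∀ i, ProperClosedConvex (P.R i)) {x y : Fin n → Model d} (hx : P.IsMinimizer x)
    (hy : P.IsMinimizer y) : x = y := by
  have hn' : (0 : ℝ) < n := by exact_mod_cast hn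
  have hN := total_pos hn hm
  have h1 := hx.variational hn hm hf hR (isMinimizer_ne_top hR hy)
  have h2 := hy.variational hn hm hf hR (isMinimizer_ne_top hR hx)
  have h3 := sum_inner_blockGrad_sub_ge hn hm hM hf hsc x y
  have h4 : ∑ i, inner ℝ (x i - y i) (P.blockGrad x i - P.blockGrad y i)
      = -∑ i, inner ℝ (P.blockGrad x i) (y i - x i)
        - ∑ i, inner ℝ (P.blockGrad y i) (x i - y i) := by
    rw [← Finset.sum_neg_distrib, ← Finset.sum_sub_distrib]
    refine Finset.sum_congr rfl fun i _ => ?_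
    rw [← neg_sub (x i) (y i), inner_neg_right, inner_sub_right, real_inner_comm (x i - y i),
      real_inner_comm (x i - y i)]
    ring
  have h5 : 0 ≤ ∑ i, ∑ j,
      weightedSq (M i j)⁻¹ (gradient (P.f i j) (x i) - gradient (P.f i j) (y i)) :=
    Finset.sum_nonneg fun i _ => Finset.sum_nonneg fun j _ => weightedSq_inv_nonneg (hM i j) _
  have h6 : 0 ≤ 1 / (2 * total m) * ∑ i, ∑ j,
      weightedSq (M i j)⁻¹ (gradient (P.f i j) (x i) - gradient (P.f i j) (y i)) := by positivity
  have h7 : 0 ≤ P.lam / n * ∑ i, ‖(x - y) i - average (x - y)‖ ^ 2 := by positivity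
  have h8 : μ / (2 * n) * ∑ i, ‖x i - y i‖ ^ 2 ≤ 0 := by linarith
  have h9 : ∑ i, ‖x i - y i‖ ^ 2 ≤ 0 := by
    by_contra! h
    have : 0 < μ / (2 * n) * ∑ i, ‖x i - y i‖ ^ 2 := by positivity
    linarith
  funext i
  have h10 : ‖x i - y i‖ ^ 2 ≤ 0 :=
    (Finset.single_le_sum (f := fun i => ‖x i - y i‖ ^ 2) (fun j _ => by positivity)
      (Finset.mem_univ i)).trans h9
  have h11 : ‖x i - y i‖ = 0 := by nlinarith [norm_nonneg (x i - y i)]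
  exact sub_eq_zero.1 (norm_eq_zero.1 h11)

/-- A proximal step contracts towards the minimizer: it moves the models no further from it than
the underlying gradient steps of the iterate and of the minimizer are from each other. -/
theorem IsMinimizer.sum_norm_prox_sub_sq_le (hn : 0 < n) (hm : ∀ i, 0 < m i)
    (hf : ∀ i j, ConvexMatrixSmooth (M i j) (P.f i j)) (hR : ∀ i, ProperClosedConvex (P.R i))
    {xs : Fin n → Model d} (hx : P.IsMinimizer xs) {α : ℝ} (hα : 0 < α) (x g : Fin n → Model d) :
    ∑ i, ‖prox α (P.R i) (x i - α • g i) - xs i‖ ^ 2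
      ≤ ∑ i, ‖(x i - xs i) - α • (g i - P.blockGrad xs i)‖ ^ 2 := by
  set u : Fin n → Model d := fun i => prox α (P.R i) (x i - α • g i) with hu
  have hprox : ∀ i, IsProx α (P.R i) (x i - α • g i) (u i) := fun i => prox_isProx hα (hR i) _
  have h1 := hx.variational hn hm hf hR (fun i => (hprox i).ne_top hα (hR i))
  have h2 := Finset.sum_le_sum fun i (_ : i ∈ Finset.univ) =>
    (hprox i).variational hα (hR i) (isMinimizer_ne_top hR hx i)
  rw [Finset.sum_add_distrib, ← Finset.mul_sum, ← Finset.mul_sum] at h2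
  have h3 := mul_le_mul_of_nonneg_left h1 hα.le
  have h4 : ∑ i, inner ℝ (x i - α • g i - u i) (xs i - u i)
      ≤ ∑ i, α * inner ℝ (P.blockGrad xs i) (u i - xs i) := by
    rw [← Finset.mul_sum]; linarith
  have h5 : ∑ i, (‖u i - xs i‖ ^ 2 - ‖(x i - xs i) - α • (g i - P.blockGrad xs i)‖ ^ 2)
      ≤ ∑ i, 2 * (inner ℝ (x i - α • g i - u i) (xs i - u i)
        - α * inner ℝ (P.blockGrad xs i) (u i - xs i)) := by
    refine Finset.sum_le_sum fun i _ => ?_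
    set b := (x i - xs i) - α • (g i - P.blockGrad xs i) with hb
    have e1 : x i - α • g i - u i = b - (u i - xs i) - α • P.blockGrad xs i := by
      rw [hb]; module
    rw [e1, ← neg_sub (u i) (xs i), inner_neg_right]
    simp only [inner_sub_left b (u i - xs i), inner_sub_left (b - (u i - xs i)),
      real_inner_smul_left, real_inner_self_eq_norm_sq]
    have h6 := norm_sub_sq_real b (u i - xs i)
    nlinarith [sq_nonneg ‖b - (u i - xs i)‖]
  rw [← Finset.mul_sum, Finset.sum_sub_distrib, Finset.sum_sub_distrib] at h5
  linarith

end Problem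

/-! ### Expectation over one draw -/

/-- A draw is a coin, a set of clients and a family of local subsets. -/
def drawEquiv (n : ℕ) (m : Fin n → ℕ) :
    Draw n m ≃ Bool × Finset (Fin n) × ((i : Fin n) → Finset (Fin (m i))) where
  toFun δ := (δ.coin, δ.active, δ.batch)
  invFun q := ⟨q.1, q.2.1, q.2.2⟩
  left_inv _ := rfl
  right_inv _ := rfl

instance : Fintype (Draw n m) := Fintype.ofEquiv _ (drawEquiv n m).symm

theorem sum_toReal_pmf {κ : Type*} [Fintype κ] (D : PMF κ) : ∑ a, (D a).toReal = 1 := by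
  rw [← ENNReal.toReal_sum fun a _ => D.apply_ne_top a, ← tsum_fintype (L := .unconditional _),
    D.tsum_coe, ENNReal.toReal_one]

/-- Marginalization: under a product distribution, the expectation of a function of one
coordinate is its expectation under the corresponding factor. -/
theorem sum_prod_smul_eval {ι E : Type*} [Fintype ι] [DecidableEq ι] {κ : ι → Type*}
    [∀ i, Fintype (κ i)] [AddCommGroup E] [Module ℝ E] (w : (i : ι) → κ i → ℝ)
    (hw : ∀ i, ∑ a, w i a = 1) (i : ι) (h : κ i → E) :
    ∑ b : (i : ι) → κ i, (∏ k, w k (b k)) • h (b i) = ∑ a, w i a • h a := by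
  rw [← (Equiv.piSplitAt i κ).symm.sum_comp, Fintype.sum_prod_type]
  refine Finset.sum_congr rfl fun a _ => ?_
  have h1 : ∀ b : (j : {j // j ≠ i}) → κ j, (∏ k, w k ((Equiv.piSplitAt i κ).symm (a, b) k))
      = w i a * ∏ k : {j // j ≠ i}, w k (b k) := by
    intro b
    rw [Fintype.prod_eq_mul_prod_subtype_ne _ i]
    congr 1
    · simp [Equiv.piSplitAt]
    · refine Finset.prod_congr rfl fun k _ => ?_
      simp [Equiv.piSplitAt, k.2]
  have h2 : ∀ b : (j : {j // j ≠ i}) → κ j, (Equiv.piSplitAt i κ).symm (a, b) i = a := by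
    intro b; simp [Equiv.piSplitAt]
  simp only [h1, h2, ← Finset.sum_smul, ← Finset.mul_sum]
  have h3 := Finset.prod_univ_sum (fun _ => Finset.univ) fun (k : {j // j ≠ i}) => w k
  simp only [hw, Finset.prod_const_one, Fintype.piFinset_univ] at h3
  rw [← h3, mul_one]

theorem sum_smul_ite_mem {ι E : Type*} [Fintype ι] [DecidableEq ι] [AddCommGroup E] [Module ℝ E]
    (D : PMF (Finset ι)) (a : ι) (x y : E) :
    ∑ A, (D A).toReal • (if a ∈ A then x else y)
      = inclusionProb D a • x + (1 - inclusionProb D a) • y := by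
  have h : ∀ A : Finset ι, (D A).toReal • (if a ∈ A then x else y)
      = (if a ∈ A then (D A).toReal else 0) • (x - y) + (D A).toReal • y := by
    intro A
    split_ifs
    · module
    · module
  simp only [h, Finset.sum_add_distrib, ← Finset.sum_smul, sum_toReal_pmf]
  rw [inclusionProb]
  module

theorem sum_smul_sum_mem {ι E : Type*} [Fintype ι] [DecidableEq ι] [AddCommGroup E] [Module ℝ E]
    (D : PMF (Finset ι)) (c : ι → E) :
    ∑ B, (D B).toReal • ∑ j ∈ B, c j = ∑ j, inclusionProb D j • c j := by
  have h : ∀ B : Finset ι, (D B).toReal • ∑ j ∈ B, c j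
      = ∑ j, (D B).toReal • (if j ∈ B then c j else 0) := by
    intro B
    rw [← Finset.smul_sum, Finset.sum_ite_mem, Finset.univ_inter]
  simp only [h]
  rw [Finset.sum_comm]
  refine Finset.sum_congr rfl fun j _ => ?_
  rw [sum_smul_ite_mem, smul_zero, add_zero]

namespace Sampling

variable {E : Type*} [AddCommGroup E] [Module ℝ E]

/-- The expectation of a function of one draw. -/
noncomputable def expect (S : Sampling n m) (h : Draw n m → E) : E :=
  ∑ δ, S.drawProb δ • h δ

theorem expect_add (S : Sampling n m) (h h' : Draw n m → E) :
    S.expect (fun δ => h δ + h' δ) = S.expect h + S.expect h' := by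
  simp only [expect, smul_add, Finset.sum_add_distrib]

theorem expect_sum {ι : Type*} (S : Sampling n m) (s : Finset ι) (h : ι → Draw n m → E) :
    S.expect (fun δ => ∑ i ∈ s, h i δ) = ∑ i ∈ s, S.expect (h i) := by
  simp only [expect, Finset.smul_sum]
  exact Finset.sum_comm

theorem expect_mul_left (S : Sampling n m) (c : ℝ) (h : Draw n m → ℝ) :
    S.expect (fun δ => c * h δ) = c * S.expect h := by
  simp only [expect, Finset.mul_sum, smul_eq_mul]
  exact Finset.sum_congr rfl fun _ _ => by ring

theorem drawProb_nonneg (S : Sampling n m) (hp0 : 0 ≤ S.p) (hp1 : S.p ≤ 1) (δ : Draw n m) :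
    0 ≤ S.drawProb δ := by
  have : 0 ≤ if δ.coin then S.p else 1 - S.p := by split_ifs <;> linarith
  exact mul_nonneg (mul_nonneg this ENNReal.toReal_nonneg)
    (Finset.prod_nonneg fun _ _ => ENNReal.toReal_nonneg)

theorem expect_mono (S : Sampling n m) (hp0 : 0 ≤ S.p) (hp1 : S.p ≤ 1) {h h' : Draw n m → ℝ}
    (hle : ∀ δ, h δ ≤ h' δ) : S.expect h ≤ S.expect h' :=
  Finset.sum_le_sum fun δ _ => mul_le_mul_of_nonneg_left (hle δ) (S.drawProb_nonneg hp0 hp1 δ)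

/-- The expectation of a random variable that depends on the coin, on whether client `i` is
active, and on the subset sampled by client `i`. -/
theorem expect_client (S : Sampling n m) (i : Fin n) (T Z : E) (F : Finset (Fin (m i)) → E) :
    S.expect (fun δ => if δ.coin then T else if i ∈ δ.active then F (δ.batch i) else Z)
      = S.p • T + ((1 - S.p) * S.clientProb i) • ∑ B, (S.loc i B).toReal • F B
        + ((1 - S.p) * (1 - S.clientProb i)) • Z := by
  have key : ∀ c A, ∑ b : (i : Fin n) → Finset (Fin (m i)), S.drawProb ⟨c, A, b⟩ •
      (if c then T else if i ∈ A then F (b i) else Z)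
      = (if c then S.p else 1 - S.p) • (S.clients A).toReal •
        (if c then T else if i ∈ A then ∑ B, (S.loc i B).toReal • F B else Z) := by
    intro c A
    have hd : ∀ b, S.drawProb ⟨c, A, b⟩ = (if c then S.p else 1 - S.p)
        * (S.clients A).toReal * ∏ i, (S.loc i (b i)).toReal := fun b => rfl
    simp only [hd, mul_smul]
    rw [← Finset.smul_sum, ← Finset.smul_sum]
    congr 2
    rw [sum_prod_smul_eval (fun i B => (S.loc i B).toReal) (fun i => sum_toReal_pmf _) i
      fun B => if c then T else if i ∈ A then F B else Z]
    split_ifs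
    · rw [← Finset.sum_smul, sum_toReal_pmf, one_smul]
    · rfl
    · rw [← Finset.sum_smul, sum_toReal_pmf, one_smul]
  rw [expect, ← (drawEquiv n m).symm.sum_comp, Fintype.sum_prod_type]
  simp only [Fintype.sum_prod_type]
  have h1 : ∀ c, (∑ A, ∑ b : (i : Fin n) → Finset (Fin (m i)),
      S.drawProb ((drawEquiv n m).symm (c, A, b)) •
      (if ((drawEquiv n m).symm (c, A, b)).coin then T
        else if i ∈ ((drawEquiv n m).symm (c, A, b)).active then
          F (((drawEquiv n m).symm (c, A, b)).batch i) else Z))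
      = (if c then S.p else 1 - S.p) • ∑ A, (S.clients A).toReal •
        (if c then T else if i ∈ A then ∑ B, (S.loc i B).toReal • F B else Z) := by
    intro c
    rw [Finset.smul_sum]
    exact Finset.sum_congr rfl fun A _ => key c A
  simp only [h1, Fintype.sum_bool, if_true, Bool.false_eq_true, if_false, sum_smul_ite_mem,
    ← Finset.sum_smul, sum_toReal_pmf, one_smul]
  rw [← clientProb]
  module

theorem sum_drawProb (S : Sampling n m) (hn : 0 < n) : ∑ δ, S.drawProb δ = 1 := by
  have h := S.expect_client (E := ℝ) ⟨0, hn⟩ 1 1 fun _ => 1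
  simp only [expect, ite_self, smul_eq_mul, mul_one, sum_toReal_pmf] at h
  rw [h]; ring

end Sampling

/-- Second-moment bound for a gradient step with a shifted estimator `A - (Z - 𝔼 Z)`: the shift
costs at most the second moment of `Z`. -/
theorem sum_norm_sub_smul_sq_le {κ E : Type*} [Fintype κ] [NormedAddCommGroup E]
    [InnerProductSpace ℝ E] {q : κ → ℝ} (hq : ∀ k, 0 ≤ q k) (hq1 : ∑ k, q k = 1) (α : ℝ) (y : E)
    (A Z : κ → E) :
    ∑ k, q k * ‖y - α • (A k - Z k + ∑ l, q l • Z l)‖ ^ 2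
      ≤ ‖y‖ ^ 2 - 2 * α * inner ℝ y (∑ k, q k • A k)
        + 2 * α ^ 2 * (∑ k, q k * ‖A k‖ ^ 2 + ∑ k, q k * ‖Z k‖ ^ 2) := by
  set z := ∑ l, q l • Z l with hz
  have h1 : ∀ k, q k * ‖y - α • (A k - Z k + z)‖ ^ 2 ≤ q k * ‖y‖ ^ 2
      - 2 * α * inner ℝ y (q k • A k) + 2 * α * inner ℝ y (q k • Z k)
      - q k * (2 * α * inner ℝ y z)
      + 2 * α ^ 2 * (q k * ‖A k‖ ^ 2) + 2 * α ^ 2 * (q k * ‖Z k‖ ^ 2)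
      - 4 * α ^ 2 * inner ℝ z (q k • Z k) + q k * (2 * α ^ 2 * ‖z‖ ^ 2) := by
    intro k
    have e1 : A k - Z k + z = A k - (Z k - z) := by abel
    have e2 : ‖A k - (Z k - z)‖ ^ 2 ≤ 2 * ‖A k‖ ^ 2 + 2 * ‖Z k - z‖ ^ 2 := by
      have := parallelogram_law_with_norm ℝ (A k) (Z k - z)
      nlinarith [sq_nonneg ‖A k + (Z k - z)‖]
    rw [norm_sub_smul_sq, e1]
    rw [norm_sub_sq_real (Z k) z] at e2
    have e3 : inner ℝ y (A k - (Z k - z)) = inner ℝ y (A k) - inner ℝ y (Z k) + inner ℝ y z := by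
      rw [inner_sub_right, inner_sub_right]; ring
    rw [e3, real_inner_smul_right, real_inner_smul_right, real_inner_smul_right,
      real_inner_comm (Z k) z]
    have e4 := mul_le_mul_of_nonneg_left e2 (mul_nonneg (hq k) (sq_nonneg α))
    linarith
  refine (Finset.sum_le_sum fun k _ => h1 k).trans (le_of_sub_nonneg ?_)
  simp only [Finset.sum_add_distrib, Finset.sum_sub_distrib, ← Finset.sum_mul, ← Finset.mul_sum,
    ← inner_sum, hq1, ← hz, real_inner_self_eq_norm_sq]
  have : 0 ≤ 2 * α ^ 2 * ‖z‖ ^ 2 := by positivity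
  linarith

/-! ### The gradient estimator -/

/-- The importance-weighted estimator of `(1/n) u + (1/N) ∑_j c_j` formed by client `i`: it sees
`u` in an aggregation step, and the sampled `c_j` in a local step in which it is active. -/
noncomputable def blockEstimator (S : Sampling n m) (i : Fin n) (c : Fin (m i) → Model d)
    (u : Model d) (δ : Draw n m) : Model d :=
  if δ.coin then (1 / ((n : ℝ) * S.p)) • u
  else if i ∈ δ.active then
    (1 / (total m * (1 - S.p) * S.clientProb i)) •
      ∑ j ∈ δ.batch i, (S.indexProb i j)⁻¹ • c j
  else 0

theorem expect_blockEstimator (hn : 0 < n) (hm : ∀ i, 0 < m i) (S : Sampling n m)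
    (hp0 : 0 < S.p) (hp1 : S.p < 1) (i : Fin n) (hclient : 0 < S.clientProb i)
    (hindex : ∀ j, 0 < S.indexProb i j) (c : Fin (m i) → Model d) (u : Model d) :
    S.expect (blockEstimator S i c u) = (1 / (n : ℝ)) • u + (1 / total m) • ∑ j, c j := by
  have hN := total_pos hn hm
  have hp1' : 0 < 1 - S.p := by linarith
  have h := S.expect_client i ((1 / ((n : ℝ) * S.p)) • u) 0 fun B =>
    (1 / (total m * (1 - S.p) * S.clientProb i)) • ∑ j ∈ B, (S.indexProb i j)⁻¹ • c j
  have e : ∑ B, (S.loc i B).toReal •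
      ((1 / (total m * (1 - S.p) * S.clientProb i)) • ∑ j ∈ B, (S.indexProb i j)⁻¹ • c j)
      = (1 / (total m * (1 - S.p) * S.clientProb i)) • ∑ j, c j := by
    simp only [smul_comm _ (1 / (total m * (1 - S.p) * S.clientProb i)), ← Finset.smul_sum]
    rw [sum_smul_sum_mem]
    congr 1
    refine Finset.sum_congr rfl fun j _ => ?_
    rw [smul_smul, ← Sampling.indexProb, mul_inv_cancel₀ (hindex j).ne', one_smul]
  rw [e, smul_zero, add_zero, smul_smul, smul_smul] at h
  refine h.trans ?_
  congr 2
  · field_simp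
  · field_simp

/-- The second moment of the estimator, bounded by means of the ESO inequality. -/
theorem expect_norm_blockEstimator_sq_le (hn : 0 < n) (hm : ∀ i, 0 < m i)
    {M : (i : Fin n) → Fin (m i) → Matrix (Fin d) (Fin d) ℝ} (hM : ∀ i j, (M i j).PosDef)
    (S : Sampling n m) (hp0 : 0 < S.p) (hp1 : S.p < 1) {v : (i : Fin n) → Fin (m i) → ℝ}
    (hv : S.ESO M v) (i : Fin n) (hclient : 0 < S.clientProb i)
    (hindex : ∀ j, 0 < S.indexProb i j) (c : Fin (m i) → Model d) (u : Model d) :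
    S.expect (fun δ => ‖blockEstimator S i c u δ‖ ^ 2)
      ≤ 1 / ((n : ℝ) ^ 2 * S.p) * ‖u‖ ^ 2 + ∑ j, v i j /
          (total m ^ 2 * (1 - S.p) * S.clientProb i * S.indexProb i j)
            * weightedSq (M i j)⁻¹ (c j) := by
  have hN := total_pos hn hm
  have hp1' : 0 < 1 - S.p := by linarith
  have hn' : (0 : ℝ) < n := by exact_mod_cast hn
  set κ := 1 / (total m * (1 - S.p) * S.clientProb i) with hκ
  have hite : (fun δ => ‖blockEstimator S i c u δ‖ ^ 2) = fun δ : Draw n m =>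
      if δ.coin then ‖(1 / ((n : ℝ) * S.p)) • u‖ ^ 2 else if i ∈ δ.active then
        ‖κ • ∑ j ∈ δ.batch i, (S.indexProb i j)⁻¹ • c j‖ ^ 2 else 0 := by
    funext δ
    rw [blockEstimator]
    split_ifs <;> simp [hκ]
  rw [hite, S.expect_client i _ 0 fun B => ‖κ • ∑ j ∈ B, (S.indexProb i j)⁻¹ • c j‖ ^ 2]
  choose h hh1 hh2 using fun j => exists_sqrt_preimage (hM i j) (c j)
  have heso := hv i fun j => (S.indexProb i j)⁻¹ • h j
  simp only [map_smul, hh1, norm_smul, mul_pow, hh2, Real.norm_eq_abs, sq_abs] at heso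
  simp only [norm_smul, mul_pow, Real.norm_eq_abs, sq_abs, smul_eq_mul, mul_zero, add_zero]
  have e1 : ∑ B, (S.loc i B).toReal * (κ ^ 2 * ‖∑ j ∈ B, (S.indexProb i j)⁻¹ • c j‖ ^ 2)
      = κ ^ 2 * ∑ B, (S.loc i B).toReal * ‖∑ j ∈ B, (S.indexProb i j)⁻¹ • c j‖ ^ 2 := by
    rw [Finset.mul_sum]
    exact Finset.sum_congr rfl fun _ _ => by ring
  rw [e1]
  have h1 : (1 - S.p) * S.clientProb i * (κ ^ 2 * ∑ B, (S.loc i B).toReal *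
      ‖∑ j ∈ B, (S.indexProb i j)⁻¹ • c j‖ ^ 2) ≤ (1 - S.p) * S.clientProb i * (κ ^ 2 *
      ∑ j, S.indexProb i j * v i j * ((S.indexProb i j)⁻¹ ^ 2 * weightedSq (M i j)⁻¹ (c j))) := by
    gcongr
  refine add_le_add (le_of_eq ?_) (h1.trans (le_of_eq ?_))
  · field_simp
  · rw [Finset.mul_sum, Finset.mul_sum]
    refine Finset.sum_congr rfl fun j _ => ?_
    have := (hindex j).ne'
    rw [hκ]
    field_simp

/-! ### One iteration -/

/-- The gradient estimator of the algorithm, in either kind of step. -/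
noncomputable def gradEstimator (P : Problem d n m) (S : Sampling n m) (s : State d n m)
    (δ : Draw n m) (i : Fin n) : Model d :=
  if δ.coin then aggregationGrad P S s i else localGrad P S s δ i

theorem step_x (P : Problem d n m) (S : Sampling n m) (α : ℝ) (s : State d n m) (δ : Draw n m)
    (i : Fin n) :
    (step P S α s δ).x i = prox α (P.R i) (s.x i - α • gradEstimator P S s δ i) := by
  unfold step gradEstimator
  split_ifs <;> rfl

/-- The error of the gradient estimator relative to the gradient at `z` is an estimator fed with
the current gradient differences, minus the centred estimator fed with the errors of the control
variates. -/
theorem gradEstimator_sub_blockGrad (P : Problem d n m) (S : Sampling n m) (s : State d n m)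
    (δ : Draw n m) (z : Fin n → Model d) (i : Fin n) :
    gradEstimator P S s δ i - P.blockGrad z i
      = blockEstimator S i (fun j => gradient (P.f i j) (s.x i) - gradient (P.f i j) (z i))
          (P.lam • ((s.x - z) i - average (s.x - z))) δ
        - blockEstimator S i (fun j => s.J i j - gradient (P.f i j) (z i))
          (s.Ψ i - P.lam • (z i - average z)) δ
        + ((1 / (n : ℝ)) • (s.Ψ i - P.lam • (z i - average z))
          + (1 / total m) • ∑ j, (s.J i j - gradient (P.f i j) (z i))) := by
  rw [average_sub, Pi.sub_apply, Finset.sum_sub_distrib, Problem.blockGrad]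
  unfold gradEstimator blockEstimator
  by_cases hc : δ.coin
  · rw [if_pos hc, if_pos hc, if_pos hc, aggregationGrad]
    module
  · rw [if_neg hc, if_neg hc, if_neg hc, localGrad]
    by_cases hi : i ∈ δ.active
    · simp only [if_pos hi]
      have e : ∑ j ∈ δ.batch i, (S.indexProb i j)⁻¹ • (gradient (P.f i j) (s.x i) - s.J i j)
          = ∑ j ∈ δ.batch i, (S.indexProb i j)⁻¹ •
              (gradient (P.f i j) (s.x i) - gradient (P.f i j) (z i))
            - ∑ j ∈ δ.batch i, (S.indexProb i j)⁻¹ • (s.J i j - gradient (P.f i j) (z i)) := by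
        rw [← Finset.sum_sub_distrib]
        refine Finset.sum_congr rfl fun j _ => ?_
        rw [← smul_sub, sub_sub_sub_cancel_right]
      rw [e]
      module
    · simp only [if_neg hi]
      module

theorem expect_weightedSq_J_step (P : Problem d n m) (S : Sampling n m) (α : ℝ)
    (s : State d n m) (z : Fin n → Model d) (A : Matrix (Fin d) (Fin d) ℝ) (i : Fin n)
    (j : Fin (m i)) :
    S.expect (fun δ => weightedSq A ((step P S α s δ).J i j - gradient (P.f i j) (z i)))
      = (1 - S.p) * S.clientProb i * S.indexProb i j *
          weightedSq A (gradient (P.f i j) (s.x i) - gradient (P.f i j) (z i))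
        + (1 - (1 - S.p) * S.clientProb i * S.indexProb i j) *
          weightedSq A (s.J i j - gradient (P.f i j) (z i)) := by
  set a := weightedSq A (gradient (P.f i j) (s.x i) - gradient (P.f i j) (z i))
  set b := weightedSq A (s.J i j - gradient (P.f i j) (z i))
  have h : (fun δ => weightedSq A ((step P S α s δ).J i j - gradient (P.f i j) (z i)))
      = fun δ : Draw n m => if δ.coin then b
        else if i ∈ δ.active then (if j ∈ δ.batch i then a else b) else b := by
    funext δ
    unfold step
    by_cases hc : δ.coin <;> by_cases hi : i ∈ δ.active <;> by_cases hj : j ∈ δ.batch i <;>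
      simp [hc, hi, hj, a, b]
  rw [h, S.expect_client i b b fun B => if j ∈ B then a else b, sum_smul_ite_mem,
    ← Sampling.indexProb]
  simp only [smul_eq_mul]
  ring

theorem expect_norm_Ψ_step_sq (P : Problem d n m) (S : Sampling n m) (α : ℝ)
    (s : State d n m) (z : Fin n → Model d) (i : Fin n) :
    S.expect (fun δ => ‖(step P S α s δ).Ψ i - P.lam • (z i - average z)‖ ^ 2)
      = S.p * ‖P.lam • ((s.x - z) i - average (s.x - z))‖ ^ 2
        + (1 - S.p) * ‖s.Ψ i - P.lam • (z i - average z)‖ ^ 2 := by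
  set b := ‖s.Ψ i - P.lam • (z i - average z)‖ ^ 2
  have h : (fun δ => ‖(step P S α s δ).Ψ i - P.lam • (z i - average z)‖ ^ 2)
      = fun δ : Draw n m => if δ.coin then ‖P.lam • ((s.x - z) i - average (s.x - z))‖ ^ 2
        else if i ∈ δ.active then b else b := by
    funext δ
    unfold step
    by_cases hc : δ.coin
    · simp only [hc, if_true]
      rw [← smul_sub, average_sub, Pi.sub_apply]
      congr 3
      abel
    · simp [hc, b]
  rw [h, S.expect_client i _ b fun _ => b, ← Finset.sum_smul, sum_toReal_pmf]
  simp only [smul_eq_mul]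
  ring

/-- The expected squared distance after one step, before the constants are absorbed. -/
theorem expect_distSq_step_le (hn : 0 < n) (hm : ∀ i, 0 < m i) {P : Problem d n m}
    {M : (i : Fin n) → Fin (m i) → Matrix (Fin d) (Fin d) ℝ} (hM : ∀ i j, (M i j).PosDef)
    (hf : ∀ i j, ConvexMatrixSmooth (M i j) (P.f i j)) {μ : ℝ}
    (hsc : ∀ i, StrongConvexOn Set.univ μ (P.localObj i))
    (hR : ∀ i, ProperClosedConvex (P.R i)) {S : Sampling n m} (hp0 : 0 < S.p) (hp1 : S.p < 1)
    (hclient : ∀ i, 0 < S.clientProb i) (hindex : ∀ i j, 0 < S.indexProb i j)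
    {v : (i : Fin n) → Fin (m i) → ℝ} (hv : S.ESO M v) {α : ℝ} (hα : 0 < α)
    {xs : Fin n → Model d} (hxs : P.IsMinimizer xs) (s : State d n m) :
    S.expect (fun δ => distSq xs (step P S α s δ))
      ≤ (1 - α * μ / n) * distSq xs s
        + ∑ i, ∑ j, ((2 * α ^ 2 * (v i j /
              (total m ^ 2 * (1 - S.p) * S.clientProb i * S.indexProb i j)) - α / total m) *
            weightedSq (M i j)⁻¹ (gradient (P.f i j) (s.x i) - gradient (P.f i j) (xs i))
          + 2 * α ^ 2 * (v i j /
              (total m ^ 2 * (1 - S.p) * S.clientProb i * S.indexProb i j)) *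
            weightedSq (M i j)⁻¹ (s.J i j - gradient (P.f i j) (xs i)))
        + ∑ i, ((2 * α ^ 2 * P.lam ^ 2 / ((n : ℝ) ^ 2 * S.p) - 2 * α * P.lam / n) *
            ‖(s.x - xs) i - average (s.x - xs)‖ ^ 2
          + 2 * α ^ 2 / ((n : ℝ) ^ 2 * S.p) * ‖s.Ψ i - P.lam • (xs i - average xs)‖ ^ 2) := by
  set A : Fin n → Draw n m → Model d := fun i => blockEstimator S i
    (fun j => gradient (P.f i j) (s.x i) - gradient (P.f i j) (xs i))
    (P.lam • ((s.x - xs) i - average (s.x - xs))) with hA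
  set Z : Fin n → Draw n m → Model d := fun i => blockEstimator S i
    (fun j => s.J i j - gradient (P.f i j) (xs i))
    (s.Ψ i - P.lam • (xs i - average xs)) with hZ
  have hEA : ∀ i, ∑ δ, S.drawProb δ • A i δ = P.blockGrad s.x i - P.blockGrad xs i := fun i => by
    have h := expect_blockEstimator hn hm S hp0 hp1 i (hclient i) (hindex i)
      (fun j => gradient (P.f i j) (s.x i) - gradient (P.f i j) (xs i))
      (P.lam • ((s.x - xs) i - average (s.x - xs)))
    refine h.trans ?_
    rw [Problem.blockGrad_sub]
    module
  have hEZ := fun i => expect_blockEstimator hn hm S hp0 hp1 i (hclient i) (hindex i)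
    (fun j => s.J i j - gradient (P.f i j) (xs i)) (s.Ψ i - P.lam • (xs i - average xs))
  have h1 : ∀ δ, distSq xs (step P S α s δ) ≤ ∑ i, ‖(s.x i - xs i)
      - α • (A i δ - Z i δ + ∑ l, S.drawProb l • Z i l)‖ ^ 2 := by
    intro δ
    simp only [distSq, step_x]
    refine (hxs.sum_norm_prox_sub_sq_le hn hm hf hR hα s.x _).trans (le_of_eq ?_)
    refine Finset.sum_congr rfl fun i _ => ?_
    rw [gradEstimator_sub_blockGrad, ← hEZ i]
    rfl
  refine (S.expect_mono hp0.le hp1.le h1).trans ?_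
  rw [S.expect_sum]
  have h2 : ∀ i, S.expect (fun δ => ‖(s.x i - xs i)
      - α • (A i δ - Z i δ + ∑ l, S.drawProb l • Z i l)‖ ^ 2)
      ≤ ‖s.x i - xs i‖ ^ 2
        - 2 * α * inner ℝ (s.x i - xs i) (P.blockGrad s.x i - P.blockGrad xs i)
        + 2 * α ^ 2 * ((1 / ((n : ℝ) ^ 2 * S.p)
              * ‖P.lam • ((s.x - xs) i - average (s.x - xs))‖ ^ 2
            + ∑ j, v i j / (total m ^ 2 * (1 - S.p) * S.clientProb i * S.indexProb i j)
              * weightedSq (M i j)⁻¹ (gradient (P.f i j) (s.x i) - gradient (P.f i j) (xs i)))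
          + (1 / ((n : ℝ) ^ 2 * S.p) * ‖s.Ψ i - P.lam • (xs i - average xs)‖ ^ 2
            + ∑ j, v i j / (total m ^ 2 * (1 - S.p) * S.clientProb i * S.indexProb i j)
              * weightedSq (M i j)⁻¹ (s.J i j - gradient (P.f i j) (xs i)))) := by
    intro i
    have h3 := sum_norm_sub_smul_sq_le (S.drawProb_nonneg hp0.le hp1.le) (S.sum_drawProb hn) α
      (s.x i - xs i) (A i) (Z i)
    rw [hEA] at h3
    refine h3.trans (add_le_add le_rfl (mul_le_mul_of_nonneg_left (add_le_add ?_ ?_)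
      (by positivity)))
    · exact expect_norm_blockEstimator_sq_le hn hm hM S hp0 hp1 hv i (hclient i) (hindex i) _ _
    · exact expect_norm_blockEstimator_sq_le hn hm hM S hp0 hp1 hv i (hclient i) (hindex i) _ _
  refine (Finset.sum_le_sum fun i _ => h2 i).trans ?_
  have h4 := Problem.sum_inner_blockGrad_sub_ge hn hm hM hf hsc s.x xs
  have h5 := mul_le_mul_of_nonneg_left h4 (show 0 ≤ 2 * α by positivity)
  simp only [norm_smul, mul_pow, Real.norm_eq_abs, sq_abs, sub_mul, mul_add, one_mul,
    Finset.sum_add_distrib, Finset.sum_sub_distrib, Finset.mul_sum, distSq] at h5 ⊢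
  have e1 : ∀ i, 2 * α * (μ / (2 * n) * ‖s.x i - xs i‖ ^ 2)
      = α * μ / n * ‖s.x i - xs i‖ ^ 2 := fun i => by ring
  have e2 : ∀ i j, 2 * α * (1 / (2 * total m) * weightedSq (M i j)⁻¹
      (gradient (P.f i j) (s.x i) - gradient (P.f i j) (xs i)))
      = α / total m * weightedSq (M i j)⁻¹
        (gradient (P.f i j) (s.x i) - gradient (P.f i j) (xs i)) := fun i j => by ring
  have e3 : ∀ i, 2 * α * (P.lam / n * ‖(s.x - xs) i - average (s.x - xs)‖ ^ 2)
      = 2 * α * P.lam / n * ‖(s.x - xs) i - average (s.x - xs)‖ ^ 2 := fun i => by ring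
  have e4 : ∀ i, 2 * α ^ 2 * (1 / ((n : ℝ) ^ 2 * S.p) *
      (P.lam ^ 2 * ‖(s.x - xs) i - average (s.x - xs)‖ ^ 2))
      = 2 * α ^ 2 * P.lam ^ 2 / ((n : ℝ) ^ 2 * S.p) *
        ‖(s.x - xs) i - average (s.x - xs)‖ ^ 2 := fun i => by ring
  have e5 : ∀ i, 2 * α ^ 2 * (1 / ((n : ℝ) ^ 2 * S.p) *
      ‖s.Ψ i - P.lam • (xs i - average xs)‖ ^ 2)
      = 2 * α ^ 2 / ((n : ℝ) ^ 2 * S.p) * ‖s.Ψ i - P.lam • (xs i - average xs)‖ ^ 2 :=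
    fun i => by ring
  simp only [e1, e2, e3, e4, e5] at h5 ⊢
  simp only [← mul_assoc] at h5 ⊢
  linarith

/-- The contraction of the Lyapunov function in one step. If the penalty vanishes, its last term
is zero by convention and the control variates `Ψ` have to vanish as well. -/
theorem expect_lyapunov_step_le (hn : 0 < n) (hm : ∀ i, 0 < m i) {P : Problem d n m}
    (hlam : 0 ≤ P.lam)
    {M : (i : Fin n) → Fin (m i) → Matrix (Fin d) (Fin d) ℝ} (hM : ∀ i j, (M i j).PosDef)
    (hf : ∀ i j, ConvexMatrixSmooth (M i j) (P.f i j)) {μ : ℝ} (hμ : 0 < μ)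
    (hsc : ∀ i, StrongConvexOn Set.univ μ (P.localObj i))
    (hR : ∀ i, ProperClosedConvex (P.R i)) {S : Sampling n m} (hp0 : 0 < S.p) (hp1 : S.p < 1)
    (hclient : ∀ i, 0 < S.clientProb i) (hindex : ∀ i j, 0 < S.indexProb i j)
    {v : (i : Fin n) → Fin (m i) → ℝ} (hv : S.ESO M v) {α : ℝ} (hα : 0 < α)
    (hα1 : ∀ i j, α * (4 * v i j + total m * (μ / n))
      ≤ total m * (1 - S.p) * S.indexProb i j * S.clientProb i)
    (hα2 : α * (4 * P.lam + μ) ≤ n * S.p)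
    {xs : Fin n → Model d} (hxs : P.IsMinimizer xs) (s : State d n m)
    (hΨ : P.lam = 0 → s.Ψ = 0) :
    S.expect (fun δ => lyapunov P S M α xs (step P S α s δ))
      ≤ (1 - α * μ / n) * lyapunov P S M α xs s := by
  have hN := total_pos hn hm
  have hp1' : 0 < 1 - S.p := by linarith
  have hn' : (0 : ℝ) < n := by exact_mod_cast hn
  have h1 := expect_distSq_step_le hn hm hM hf hsc hR hp0 hp1 hclient hindex hv hα hxs s
  simp only [lyapunov, S.expect_add, S.expect_mul_left, S.expect_sum, expect_weightedSq_J_step,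
    expect_norm_Ψ_step_sq]
  have h2 : ∀ i j,
      (2 * α ^ 2 * (v i j / (total m ^ 2 * (1 - S.p) * S.clientProb i * S.indexProb i j))
          - α / total m) *
          weightedSq (M i j)⁻¹ (gradient (P.f i j) (s.x i) - gradient (P.f i j) (xs i))
        + 2 * α ^ 2 * (v i j / (total m ^ 2 * (1 - S.p) * S.clientProb i * S.indexProb i j)) *
          weightedSq (M i j)⁻¹ (s.J i j - gradient (P.f i j) (xs i))
        + α * (1 / (2 * total m * (1 - S.p) * S.indexProb i j * S.clientProb i) *
          ((1 - S.p) * S.clientProb i * S.indexProb i j *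
          weightedSq (M i j)⁻¹ (gradient (P.f i j) (s.x i) - gradient (P.f i j) (xs i))
        + (1 - (1 - S.p) * S.clientProb i * S.indexProb i j) *
          weightedSq (M i j)⁻¹ (s.J i j - gradient (P.f i j) (xs i))))
      ≤ (1 - α * μ / n) * (α * (1 / (2 * total m * (1 - S.p) * S.indexProb i j
          * S.clientProb i) * weightedSq (M i j)⁻¹ (s.J i j - gradient (P.f i j) (xs i)))) := by
    intro i j
    have ha := weightedSq_inv_nonneg (hM i j)
      (gradient (P.f i j) (s.x i) - gradient (P.f i j) (xs i))
    have hb := weightedSq_inv_nonneg (hM i j) (s.J i j - gradient (P.f i j) (xs i))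
    set a := weightedSq (M i j)⁻¹ (gradient (P.f i j) (s.x i) - gradient (P.f i j) (xs i))
    set b := weightedSq (M i j)⁻¹ (s.J i j - gradient (P.f i j) (xs i))
    have hc := hclient i
    have hi := hindex i j
    -- the numerator of the stepsize bound for the index `(i, j)`
    set W := total m * (1 - S.p) * S.indexProb i j * S.clientProb i with hW
    have hW0 : 0 < W := by positivity
    have hstep := hα1 i j
    -- the slack of the inequality, a nonnegative combination of `a` and `b` by the stepsize bound
    have e : (1 - α * μ / n) * (α * (1 / (2 * total m * (1 - S.p) * S.indexProb i j
          * S.clientProb i) * b))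
        - ((2 * α ^ 2 * (v i j / (total m ^ 2 * (1 - S.p) * S.clientProb i * S.indexProb i j))
          - α / total m) * a
        + 2 * α ^ 2 * (v i j / (total m ^ 2 * (1 - S.p) * S.clientProb i * S.indexProb i j)) * b
        + α * (1 / (2 * total m * (1 - S.p) * S.indexProb i j * S.clientProb i) *
          ((1 - S.p) * S.clientProb i * S.indexProb i j * a
        + (1 - (1 - S.p) * S.clientProb i * S.indexProb i j) * b)))
        = α / (2 * total m * W) * ((W - α * (4 * v i j)) * a
          + (W - α * (4 * v i j + total m * (μ / n))) * b) := by
      rw [hW]; field_simp; ring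
    have h3 : 0 ≤ α * (total m * (μ / n)) := by positivity
    have h4 : 0 ≤ α / (2 * total m * W) * ((W - α * (4 * v i j)) * a
          + (W - α * (4 * v i j + total m * (μ / n))) * b) :=
      mul_nonneg (by positivity) (add_nonneg (mul_nonneg (by linarith) ha)
        (mul_nonneg (by linarith) hb))
    linarith
  have h3 : ∀ i, (2 * α ^ 2 * P.lam ^ 2 / ((n : ℝ) ^ 2 * S.p) - 2 * α * P.lam / n) *
          ‖(s.x - xs) i - average (s.x - xs)‖ ^ 2
        + 2 * α ^ 2 / ((n : ℝ) ^ 2 * S.p) * ‖s.Ψ i - P.lam • (xs i - average xs)‖ ^ 2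
        + α * (1 / (2 * (n : ℝ) * P.lam * S.p) *
          (S.p * ‖P.lam • ((s.x - xs) i - average (s.x - xs))‖ ^ 2
            + (1 - S.p) * ‖s.Ψ i - P.lam • (xs i - average xs)‖ ^ 2))
      ≤ (1 - α * μ / n) * (α * (1 / (2 * (n : ℝ) * P.lam * S.p) *
          ‖s.Ψ i - P.lam • (xs i - average xs)‖ ^ 2)) := by
    intro i
    rcases hlam.eq_or_lt with h0 | h0
    -- if `λ = 0`, then `u`, `ψ` and the coefficient `1 / (2 n λ p)`, a division by zero, all vanish
    · simp [← h0, hΨ h0.symm]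
    · rw [norm_smul, mul_pow, Real.norm_eq_abs, sq_abs]
      have ht := sq_nonneg ‖(s.x - xs) i - average (s.x - xs)‖
      have hb := sq_nonneg ‖s.Ψ i - P.lam • (xs i - average xs)‖
      set t := ‖(s.x - xs) i - average (s.x - xs)‖ ^ 2
      set b := ‖s.Ψ i - P.lam • (xs i - average xs)‖ ^ 2
      have e : (1 - α * μ / n) * (α * (1 / (2 * (n : ℝ) * P.lam * S.p) * b))
          - ((2 * α ^ 2 * P.lam ^ 2 / ((n : ℝ) ^ 2 * S.p) - 2 * α * P.lam / n) * t
            + 2 * α ^ 2 / ((n : ℝ) ^ 2 * S.p) * b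
            + α * (1 / (2 * (n : ℝ) * P.lam * S.p) *
              (S.p * (P.lam ^ 2 * t) + (1 - S.p) * b)))
          = α / (2 * (n : ℝ) ^ 2 * P.lam * S.p) * ((3 * n * S.p - 4 * α * P.lam) * P.lam ^ 2 * t
            + (n * S.p - α * (4 * P.lam + μ)) * b) := by
        field_simp; ring
      have h4 : 0 ≤ α * μ := by positivity
      have h5 : (0 : ℝ) ≤ n * S.p := by positivity
      have h6 : 0 ≤ α / (2 * (n : ℝ) ^ 2 * P.lam * S.p) *
          ((3 * n * S.p - 4 * α * P.lam) * P.lam ^ 2 * t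
            + (n * S.p - α * (4 * P.lam + μ)) * b) :=
        mul_nonneg (by positivity) (add_nonneg (mul_nonneg (mul_nonneg (by linarith)
          (by positivity)) ht) (mul_nonneg (by linarith) hb))
      linarith
  have h4 := Finset.sum_le_sum fun i (_ : i ∈ Finset.univ) =>
    Finset.sum_le_sum fun j (_ : j ∈ Finset.univ) => h2 i j
  have h5 := Finset.sum_le_sum fun i (_ : i ∈ Finset.univ) => h3 i
  simp only [Finset.sum_add_distrib (M := ℝ), ← Finset.mul_sum] at h1 h4 h5 ⊢
  linarith

/-! ### The expected Lyapunov function along the iterates -/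

theorem distSq_le_lyapunov (hn : 0 < n) (hm : ∀ i, 0 < m i) {P : Problem d n m}
    (hlam : 0 ≤ P.lam)
    {M : (i : Fin n) → Fin (m i) → Matrix (Fin d) (Fin d) ℝ} (hM : ∀ i j, (M i j).PosDef)
    {S : Sampling n m} (hp0 : 0 < S.p) (hp1 : S.p < 1)
    (hclient : ∀ i, 0 < S.clientProb i) (hindex : ∀ i j, 0 < S.indexProb i j)
    {α : ℝ} (hα : 0 < α) (z : Fin n → Model d) (s : State d n m) :
    distSq z s ≤ lyapunov P S M α z s := by
  have hN := total_pos hn hm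
  have hp1' : 0 < 1 - S.p := by linarith
  refine le_add_of_nonneg_right (mul_nonneg hα.le (add_nonneg ?_ (by positivity)))
  refine Finset.sum_nonneg fun i _ => Finset.sum_nonneg fun j _ => mul_nonneg ?_
    (weightedSq_inv_nonneg (hM i j) _)
  have := hclient i
  have := hindex i j
  positivity

theorem iterates_Ψ_eq_zero {P : Problem d n m} (hlam : P.lam = 0) (S : Sampling n m) (α : ℝ)
    (x0 : Fin n → Model d) (ω : ℕ → Draw n m) (k : ℕ) : (iterates P S α x0 ω k).Ψ = 0 := by
  induction k with
  | zero => rfl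
  | succ k ih =>
    rw [iterates, step]
    split_ifs
    · funext i; simp [hlam]
    · exact ih

/-- The `k`-th iterate depends on the first `k` draws only. -/
theorem iterates_congr (P : Problem d n m) (S : Sampling n m) (α : ℝ) (x0 : Fin n → Model d)
    {ω ω' : ℕ → Draw n m} (k : ℕ) (h : ∀ l < k, ω l = ω' l) :
    iterates P S α x0 ω k = iterates P S α x0 ω' k := by
  induction k with
  | zero => rfl
  | succ k ih => rw [iterates, iterates, ih fun l hl => h l (hl.trans k.lt_succ_self),
      h k k.lt_succ_self]

/-- The `k`-th iterate as a function of the first `k` draws. -/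
noncomputable def iterateOfHistory (P : Problem d n m) (S : Sampling n m) (α : ℝ)
    (x0 : Fin n → Model d) (k : ℕ) (h : Finset.range k → Draw n m) : State d n m :=
  iterates P S α x0
    (fun l => if hl : l ∈ Finset.range k then h ⟨l, hl⟩ else ⟨true, ∅, fun _ => ∅⟩) k

theorem iterates_eq_iterateOfHistory (P : Problem d n m) (S : Sampling n m) (α : ℝ)
    (x0 : Fin n → Model d) (k : ℕ) (ω : ℕ → Draw n m) :
    iterates P S α x0 ω k = iterateOfHistory P S α x0 k fun l => ω l := by
  refine iterates_congr P S α x0 k fun l hl => ?_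
  rw [dif_pos (Finset.mem_range.2 hl)]

instance : DiscreteMeasurableSpace (Draw n m) := ⟨fun _ => trivial⟩

section Probability

open MeasureTheory ProbabilityTheory

variable {Ω : Type*} [MeasurableSpace Ω] {Q : Measure Ω} [IsProbabilityMeasure Q]

theorem integrable_comp_of_finite {κ : Type*} [Finite κ] [MeasurableSpace κ]
    [DiscreteMeasurableSpace κ] {X : Ω → κ} (hX : Measurable X) (g : κ → ℝ) :
    Integrable (fun ω => g (X ω)) Q := by
  have : IsProbabilityMeasure (Q.map X) := Measure.isProbabilityMeasure_map hX.aemeasurable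
  exact (Integrable.of_finite (μ := Q.map X) (f := g)).comp_measurable hX

/-- Fubini for independent finitely valued random variables: the second one may be averaged out
for a fixed value of the first one. -/
theorem integral_comp_prod_of_indepFun {κ κ' : Type*} [Finite κ] [MeasurableSpace κ]
    [DiscreteMeasurableSpace κ] [Fintype κ'] [MeasurableSpace κ'] [DiscreteMeasurableSpace κ']
    {X : Ω → κ} {Y : Ω → κ'} (hX : Measurable X) (hY : Measurable Y) (hXY : IndepFun X Y Q)
    (g : κ → κ' → ℝ) :
    ∫ ω, g (X ω) (Y ω) ∂Q = ∫ ω, ∑ b, Q.real {ω | Y ω = b} * g (X ω) b ∂Q := by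
  classical
  have h1 : ∀ ω, g (X ω) (Y ω) = ∑ b, g (X ω) b * (if Y ω = b then 1 else 0) := by
    intro ω; simp
  simp only [h1]
  rw [integral_finsetSum, integral_finsetSum]
  · refine Finset.sum_congr rfl fun b _ => ?_
    have hind : IndepFun (fun ω => g (X ω) b) (fun ω => if Y ω = b then (1 : ℝ) else 0) Q :=
      hXY.comp (φ := fun x => g x b) (ψ := fun y => if y = b then (1 : ℝ) else 0)
        (Measurable.of_discrete) (Measurable.of_discrete)
    have h2 := hind.integral_mul_eq_mul_integral
      (integrable_comp_of_finite hX fun x => g x b).aestronglyMeasurable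
      (integrable_comp_of_finite hY fun y => if y = b then (1 : ℝ) else 0).aestronglyMeasurable
    refine h2.trans ?_
    have hb : MeasurableSet {ω | Y ω = b} := hY (MeasurableSet.of_discrete (s := {b}))
    have h3 : ∫ ω, (if Y ω = b then (1 : ℝ) else 0) ∂Q = Q.real {ω | Y ω = b} := by
      rw [← integral_indicator_one hb]
      rfl
    rw [h3, mul_comm, integral_const_mul]
  · exact fun b _ => integrable_comp_of_finite hX fun x => Q.real {ω | Y ω = b} * g x b
  · exact fun b _ => integrable_comp_of_finite (hX.prodMk hY)
      fun q : κ × κ' => g q.1 b * (if q.2 = b then 1 else 0)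

variable {draw : ℕ → Ω → Draw n m}

theorem integrable_iterates (hdraw : ∀ k, Measurable (draw k)) (P : Problem d n m)
    (S : Sampling n m) (α : ℝ) (x0 : Fin n → Model d) (k : ℕ) (g : State d n m → ℝ) :
    Integrable (fun ω => g (iterates P S α x0 (fun l => draw l ω) k)) Q := by
  simp only [iterates_eq_iterateOfHistory]
  exact integrable_comp_of_finite (X := fun ω (l : Finset.range k) => draw l ω)
    (measurable_pi_lambda _ fun l => hdraw l) fun h => g (iterateOfHistory P S α x0 k h)

theorem integral_iterates_succ (hdraw : ∀ k, Measurable (draw k)) (hindep : iIndepFun draw Q)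
    {S : Sampling n m} (hlaw : ∀ k δ, Q.real {ω | draw k ω = δ} = S.drawProb δ)
    (P : Problem d n m) (α : ℝ) (x0 : Fin n → Model d) (k : ℕ) (g : State d n m → ℝ) :
    ∫ ω, g (iterates P S α x0 (fun l => draw l ω) (k + 1)) ∂Q
      = ∫ ω, S.expect (fun δ =>
          g (step P S α (iterates P S α x0 (fun l => draw l ω) k) δ)) ∂Q := by
  have hX : Measurable fun ω (l : Finset.range k) => draw l ω :=
    measurable_pi_lambda _ fun l => hdraw l
  have h := hindep.indepFun_finset (Finset.range k) {k} (by simp) hdraw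
  have hXY : IndepFun (fun ω (l : Finset.range k) => draw l ω) (draw k) Q :=
    h.comp measurable_id
      (measurable_pi_apply (⟨k, Finset.mem_singleton_self k⟩ : ({k} : Finset ℕ)))
  have h1 := integral_comp_prod_of_indepFun hX (hdraw k) hXY
    fun h δ => g (step P S α (iterateOfHistory P S α x0 k h) δ)
  simp only [hlaw k] at h1
  simp only [iterates, iterates_eq_iterateOfHistory P S α x0 k]
  exact h1

theorem integral_lyapunov_le (hn : 0 < n) (hm : ∀ i, 0 < m i) {P : Problem d n m}
    (hlam : 0 ≤ P.lam)
    {M : (i : Fin n) → Fin (m i) → Matrix (Fin d) (Fin d) ℝ} (hM : ∀ i j, (M i j).PosDef)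
    (hf : ∀ i j, ConvexMatrixSmooth (M i j) (P.f i j)) {μ : ℝ} (hμ : 0 < μ)
    (hsc : ∀ i, StrongConvexOn Set.univ μ (P.localObj i))
    (hR : ∀ i, ProperClosedConvex (P.R i)) {S : Sampling n m} (hp0 : 0 < S.p) (hp1 : S.p < 1)
    (hclient : ∀ i, 0 < S.clientProb i) (hindex : ∀ i j, 0 < S.indexProb i j)
    {v : (i : Fin n) → Fin (m i) → ℝ} (hv : S.ESO M v) {α : ℝ} (hα : 0 < α)
    (hα1 : ∀ i j, α * (4 * v i j + total m * (μ / n))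
      ≤ total m * (1 - S.p) * S.indexProb i j * S.clientProb i)
    (hα2 : α * (4 * P.lam + μ) ≤ n * S.p) (hrate : 0 ≤ 1 - α * μ / n)
    {xs : Fin n → Model d} (hxs : P.IsMinimizer xs) (x0 : Fin n → Model d)
    (hdraw : ∀ k, Measurable (draw k)) (hindep : iIndepFun draw Q)
    (hlaw : ∀ k δ, Q.real {ω | draw k ω = δ} = S.drawProb δ) (k : ℕ) :
    ∫ ω, lyapunov P S M α xs (iterates P S α x0 (fun l => draw l ω) k) ∂Q
      ≤ (1 - α * μ / n) ^ k * lyapunov P S M α xs (initial m x0) := by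
  induction k with
  | zero => simp [iterates]
  | succ k ih =>
    rw [integral_iterates_succ hdraw hindep hlaw]
    have h1 : ∫ ω, S.expect (fun δ => lyapunov P S M α xs
          (step P S α (iterates P S α x0 (fun l => draw l ω) k) δ)) ∂Q
        ≤ ∫ ω, (1 - α * μ / n) *
          lyapunov P S M α xs (iterates P S α x0 (fun l => draw l ω) k) ∂Q := by
      refine integral_mono ?_ ?_ fun ω => ?_
      · exact integrable_iterates hdraw P S α x0 k fun s =>
          S.expect fun δ => lyapunov P S M α xs (step P S α s δ)
      · exact (integrable_iterates hdraw P S α x0 k _).const_mul _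
      · exact expect_lyapunov_step_le hn hm hlam hM hf hμ hsc hR hp0 hp1 hclient hindex hv hα
          hα1 hα2 hxs _ fun h0 => iterates_Ψ_eq_zero h0 S α x0 _ k
    rw [integral_const_mul] at h1
    refine h1.trans ?_
    rw [pow_succ', mul_assoc]
    exact mul_le_mul_of_nonneg_left ih hrate

end Probability

/-! ### Stepsize and complexity -/

/-- The ESO inequality forces positive parameters. -/
theorem Sampling.ESO.pos (hd : 0 < d) {S : Sampling n m}
    {M : (i : Fin n) → Fin (m i) → Matrix (Fin d) (Fin d) ℝ} (hM : ∀ i j, (M i j).PosDef)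
    (hindex : ∀ i j, 0 < S.indexProb i j) {v : (i : Fin n) → Fin (m i) → ℝ}
    (hv : S.ESO M v) (i : Fin n) (j : Fin (m i)) : 0 < v i j := by
  have : Nonempty (Fin d) := ⟨⟨0, hd⟩⟩
  obtain ⟨c, hc⟩ := exists_ne (0 : Model d)
  obtain ⟨h, hh, -⟩ := exists_sqrt_preimage (hM i j) c
  -- the ESO inequality for a family supported at the single index `j`
  have heso := hv i fun k => if k = j then h else 0
  have e1 : ∀ B : Finset (Fin (m i)), (S.loc i B).toReal * ‖∑ k ∈ B,
      Matrix.toEuclideanCLM (𝕜 := ℝ) (CFC.sqrt (M i k)) (if k = j then h else 0)‖ ^ 2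
      = (S.loc i B).toReal • (if j ∈ B then ‖c‖ ^ 2 else 0) := by
    intro B
    have e2 : ∀ k, Matrix.toEuclideanCLM (𝕜 := ℝ) (CFC.sqrt (M i k)) (if k = j then h else 0)
        = if k = j then c else 0 := by
      intro k
      split_ifs with hk
      · rw [hk, hh]
      · exact map_zero _
    simp only [e2, Finset.sum_ite_eq']
    split_ifs <;> simp
  have e3 : ∑ k, S.indexProb i k * v i k * ‖if k = j then h else 0‖ ^ 2
      = S.indexProb i j * v i j * ‖h‖ ^ 2 := by
    rw [Finset.sum_eq_single j]
    · simp
    · intro k _ hk; simp [hk]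
    · simp
  simp only [e1, e3, sum_smul_ite_mem] at heso
  rw [← Sampling.indexProb, smul_zero, add_zero, smul_eq_mul, mul_assoc] at heso
  have h1 := le_of_mul_le_mul_left heso (hindex i j)
  have h2 : 0 < ‖c‖ ^ 2 := by
    have := norm_pos_iff.2 hc
    positivity
  exact pos_of_mul_pos_left (h2.trans_le h1) (sq_nonneg _)

section Stepsize

variable {P : Problem d n m} {S : Sampling n m} {μ : ℝ} {v : (i : Fin n) → Fin (m i) → ℝ}

theorem stepsize_mul_index_le (hn : 0 < n) (hm : ∀ i, 0 < m i) (hμ : 0 < μ)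
    (hvpos : ∀ i j, 0 < v i j) (i : Fin n) (j : Fin (m i)) :
    stepsize P S μ v * (4 * v i j + total m * (μ / n))
      ≤ total m * (1 - S.p) * S.indexProb i j * S.clientProb i := by
  have hN := total_pos hn hm
  have hv := hvpos i j
  rw [← le_div_iff₀ (by positivity)]
  exact (min_le_left _ _).trans (ciInf_le (Set.finite_range _).bddBelow
    (⟨i, j⟩ : (i : Fin n) × Fin (m i)))

theorem stepsize_mul_penalty_le (hlam : 0 ≤ P.lam) (hμ : 0 < μ) :
    stepsize P S μ v * (4 * P.lam + μ) ≤ n * S.p := by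
  rw [← le_div_iff₀ (by positivity)]
  exact min_le_right _ _

/-- The stepsize is one of the quantities over which the minimum is taken. -/
theorem stepsize_eq (hn : 0 < n) (hm : ∀ i, 0 < m i) :
    (∃ i j, stepsize P S μ v = total m * (1 - S.p) * S.indexProb i j * S.clientProb i
        / (4 * v i j + total m * (μ / n)))
      ∨ stepsize P S μ v = (n : ℝ) * S.p / (4 * P.lam + μ) := by
  have : Nonempty ((i : Fin n) × Fin (m i)) := ⟨⟨⟨0, hn⟩, ⟨0, hm _⟩⟩⟩
  obtain ⟨⟨i, j⟩, h⟩ := exists_eq_ciInf_of_finite (f := fun a : (i : Fin n) × Fin (m i) =>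
    total m * (1 - S.p) * S.indexProb a.1 a.2 * S.clientProb a.1
        / (4 * v a.1 a.2 + total m * (μ / n)))
  rcases min_choice (⨅ a : (i : Fin n) × Fin (m i),
    total m * (1 - S.p) * S.indexProb a.1 a.2 * S.clientProb a.1
        / (4 * v a.1 a.2 + total m * (μ / n))) ((n : ℝ) * S.p / (4 * P.lam + μ)) with h' | h'
  · exact Or.inl ⟨i, j, h'.trans h.symm⟩
  · exact Or.inr h'

theorem stepsize_pos (hn : 0 < n) (hm : ∀ i, 0 < m i) (hlam : 0 ≤ P.lam) (hμ : 0 < μ)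
    (hp0 : 0 < S.p) (hp1 : S.p < 1) (hclient : ∀ i, 0 < S.clientProb i)
    (hindex : ∀ i j, 0 < S.indexProb i j) (hvpos : ∀ i j, 0 < v i j) :
    0 < stepsize P S μ v := by
  have hN := total_pos hn hm
  have hp1' : 0 < 1 - S.p := by linarith
  rcases stepsize_eq (P := P) (S := S) (μ := μ) (v := v) hn hm with ⟨i, j, h⟩ | h
  · have := hclient i
    have := hindex i j
    have := hvpos i j
    rw [h]; positivity
  · rw [h]; positivity

/-- The complexity is at least the inverse of the rate (in fact they agree). -/
theorem one_le_complexity_mul_rate (hn : 0 < n) (hm : ∀ i, 0 < m i) (hlam : 0 ≤ P.lam)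
    (hμ : 0 < μ) (hp0 : 0 < S.p) (hp1 : S.p < 1) (hclient : ∀ i, 0 < S.clientProb i)
    (hindex : ∀ i j, 0 < S.indexProb i j) (hvpos : ∀ i j, 0 < v i j) :
    1 ≤ complexity P S μ v * (stepsize P S μ v * μ / n) := by
  have hN := total_pos hn hm
  have hp1' : 0 < 1 - S.p := by linarith
  have hpos : 0 < stepsize P S μ v := stepsize_pos hn hm hlam hμ hp0 hp1 hclient hindex hvpos
  have hn' : (0 : ℝ) < n := by exact_mod_cast hn
  have hr : 0 ≤ stepsize P S μ v * μ / n := by positivity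
  rcases stepsize_eq (P := P) (S := S) (μ := μ) (v := v) hn hm with ⟨i, j, h⟩ | h
  · have hc := hclient i
    have hi := hindex i j
    have hv := hvpos i j
    have h1 : (4 * v i j * ((n : ℝ) / total m) + μ)
        / (μ * (1 - S.p) * S.indexProb i j * S.clientProb i) ≤ complexity P S μ v :=
      (le_ciSup (f := fun a : (i : Fin n) × Fin (m i) =>
        (4 * v a.1 a.2 * ((n : ℝ) / total m) + μ)
        / (μ * (1 - S.p) * S.indexProb a.1 a.2 * S.clientProb a.1))
        (Set.finite_range _).bddAbove ⟨i, j⟩).trans (le_max_left _ _)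
    refine le_trans (le_of_eq ?_) (mul_le_mul_of_nonneg_right h1 hr)
    have h2 : 0 < 4 * v i j + total m * (μ / n) := by positivity
    have h3 : 4 * v i j * ((n : ℝ) / total m) + μ
        = n / total m * (4 * v i j + total m * (μ / n)) := by field_simp
    rw [h, h3]
    field_simp
  · have h1 : (4 * P.lam + μ) / (S.p * μ) ≤ complexity P S μ v := le_max_right _ _
    refine le_trans (le_of_eq ?_) (mul_le_mul_of_nonneg_right h1 hr)
    rw [h]
    have : 0 < 4 * P.lam + μ := by positivity
    field_simp

end Stepsize

/-- Linear convergence with rate `t` reaches accuracy `ε` within `(1/t) log (1/ε)` steps. -/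
theorem one_sub_pow_le_of_log_le {t c ε : ℝ} (ht0 : 0 < t) (ht1 : t ≤ 1) (hct : 1 ≤ c * t)
    (hε0 : 0 < ε) (hε1 : ε < 1) {k : ℕ} (hk : c * Real.log (1 / ε) ≤ k) :
    (1 - t) ^ k ≤ ε := by
  have hlog : 0 ≤ Real.log (1 / ε) := Real.log_nonneg (by rw [le_div_iff₀ hε0]; linarith)
  have h1 : (1 - t) ^ k ≤ Real.exp (-t) ^ k :=
    pow_le_pow_left₀ (by linarith) (Real.one_sub_le_exp_neg t) k
  refine h1.trans ?_
  rw [← Real.exp_nat_mul, ← Real.le_log_iff_exp_le hε0]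
  have h2 : Real.log (1 / ε) = -Real.log ε := by rw [one_div, Real.log_inv]
  have h3 := mul_le_mul_of_nonneg_right hk ht0.le
  have h4 := mul_le_mul_of_nonneg_right hct hlog
  rw [h2] at h3 h4
  linarith

end L2SGD

theorem mainTheorem8
    {d n : ℕ} (hd : 0 < d) (hn : 0 < n) (m : Fin n → ℕ) (hm : ∀ i, 0 < m i)
    (P : L2SGD.Problem d n m) (hlam : 0 ≤ P.lam)
    (M : (i : Fin n) → Fin (m i) → Matrix (Fin d) (Fin d) ℝ) (hM : ∀ i j, (M i j).PosDef)
    (hf : ∀ i j, L2SGD.ConvexMatrixSmooth (M i j) (P.f i j))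
    (μ : ℝ) (hμ : 0 < μ) (hsc : ∀ i, StrongConvexOn Set.univ μ (P.localObj i))
    (hR : ∀ i, L2SGD.ProperClosedConvex (P.R i))
    (S : L2SGD.Sampling n m) (hp0 : 0 < S.p) (hp1 : S.p < 1)
    (hclient : ∀ i, 0 < S.clientProb i) (hindex : ∀ i j, 0 < S.indexProb i j)
    (v : (i : Fin n) → Fin (m i) → ℝ) (hv : S.ESO M v)
    (α : ℝ) (hα : α = L2SGD.stepsize P S μ v)
    (x0 : Fin n → L2SGD.Model d)
    {Ω : Type*} [MeasurableSpace Ω] (ℙ : MeasureTheory.Measure Ω)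
    [MeasureTheory.IsProbabilityMeasure ℙ]
    (draw : ℕ → Ω → L2SGD.Draw n m) (hdraw : ∀ k, Measurable (draw k))
    (hindep : ProbabilityTheory.iIndepFun draw ℙ)
    (hlaw : ∀ k δ, ℙ.real {ω | draw k ω = δ} = S.drawProb δ) :
    0 < α ∧ 0 < α * μ / n ∧ α * μ / n < 1 ∧
    ∃ xs : Fin n → L2SGD.Model d,
      P.IsMinimizer xs ∧ (∀ y, P.IsMinimizer y → y = xs) ∧
      (∀ k : ℕ,
        MeasureTheory.Integrable (fun ω =>
          L2SGD.lyapunov P S M α xs (L2SGD.iterates P S α x0 (fun l => draw l ω) k)) ℙ ∧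
        MeasureTheory.Integrable (fun ω =>
          L2SGD.distSq xs (L2SGD.iterates P S α x0 (fun l => draw l ω) k)) ℙ ∧
        ∫ ω, L2SGD.lyapunov P S M α xs (L2SGD.iterates P S α x0 (fun l => draw l ω) k) ∂ℙ
          ≤ (1 - α * μ / n) ^ k * L2SGD.lyapunov P S M α xs (L2SGD.initial m x0)) ∧
      (∀ ε : ℝ, 0 < ε → ε < 1 → ∀ k : ℕ,
        L2SGD.complexity P S μ v * Real.log (1 / ε) ≤ k →
        ∫ ω, L2SGD.lyapunov P S M α xs (L2SGD.iterates P S α x0 (fun l => draw l ω) k) ∂ℙ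
          ≤ ε * L2SGD.lyapunov P S M α xs (L2SGD.initial m x0) ∧
        ∫ ω, L2SGD.distSq xs (L2SGD.iterates P S α x0 (fun l => draw l ω) k) ∂ℙ
          ≤ ε * L2SGD.lyapunov P S M α xs (L2SGD.initial m x0)) := by
  subst hα
  have hvpos := hv.pos hd hM hindex
  have hn' : (0 : ℝ) < n := by exact_mod_cast hn
  have hα : 0 < L2SGD.stepsize P S μ v :=
    L2SGD.stepsize_pos hn hm hlam hμ hp0 hp1 hclient hindex hvpos
  have hα2 : L2SGD.stepsize P S μ v * (4 * P.lam + μ) ≤ n * S.p :=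
    L2SGD.stepsize_mul_penalty_le hlam hμ
  have hrate0 : 0 < L2SGD.stepsize P S μ v * μ / n := by positivity
  have hrate1 : L2SGD.stepsize P S μ v * μ / n < 1 := by
    rw [div_lt_one hn']
    have h1 : 0 ≤ L2SGD.stepsize P S μ v * P.lam := by positivity
    have h2 : (n : ℝ) * S.p < n := by nlinarith
    linarith
  obtain ⟨xs, hxs⟩ := L2SGD.Problem.exists_isMinimizer hn hlam hf hμ hsc hR
  have hdist := L2SGD.distSq_le_lyapunov hn hm hlam hM hp0 hp1 hclient hindex hα xs
  have hV := L2SGD.integral_lyapunov_le hn hm hlam hM hf hμ hsc hR hp0 hp1 hclient hindex hv hα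
    (L2SGD.stepsize_mul_index_le hn hm hμ hvpos) hα2 (by linarith) hxs x0 hdraw hindep hlaw
  have hint := fun k => L2SGD.integrable_iterates (Q := ℙ) hdraw P S (L2SGD.stepsize P S μ v) x0 k
  refine ⟨hα, hrate0, hrate1, xs, hxs, fun y hy => L2SGD.Problem.isMinimizer_unique hn hm hlam hM
    hf hμ hsc hR hy hxs, fun k => ⟨hint k _, hint k _, hV k⟩, fun ε hε0 hε1 k hk => ?_⟩
  have hV0 : 0 ≤ L2SGD.lyapunov P S M (L2SGD.stepsize P S μ v) xs (L2SGD.initial m x0) :=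
    le_trans (Finset.sum_nonneg fun i _ => sq_nonneg _) (hdist _)
  have hε := (hV k).trans (mul_le_mul_of_nonneg_right (L2SGD.one_sub_pow_le_of_log_le hrate0
    hrate1.le (L2SGD.one_le_complexity_mul_rate hn hm hlam hμ hp0 hp1 hclient hindex hvpos)
    hε0 hε1 hk) hV0)
  exact ⟨hε, (MeasureTheory.integral_mono (hint k _) (hint k _) fun ω => hdist _).trans hε⟩
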